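/- Let $M$ be an orientable smooth 3-dimensional manifold (Hausdorff, second countable) with a Poisson structure $\Lambda$ that is regular of rank $2$, and let $F$ be its symplectic foliation, $TF=\#(T^*M)$, where $\#:T^*M\to TM$ is defined by $\beta(\alpha^\#)=\Lambda(\alpha,\beta)$. Suppose that $F$ is defined by a closed 1-form $\beta$: $d\beta=0$ and $\ker\beta_x=T_xF$ for every $x\in M$. Let $\nu F$ be any smooth distribution with $TM=TF\oplus\nu F$. Notation. Let $\sigma$ be the Poisson differential on the multivector fields $\mathcal V^k(M)$, viewed as alternating $C^\infty(M)$-multilinear maps on 1-forms: $$(\sigma Q)(\alpha_0,\dots,\alpha_k)=\sum_i(-1)^i\alpha_i^\#\big(Q(\dots,\widehat{\alpha_i},\dots)\big)+\sum_{i<j}(-1)^{i+j}Q(\{\alpha_i,\alpha_j\},\dots,\widehat{\alpha_i},\dots,\widehat{\alpha_j},\dots),$$ with $\{\alpha,\beta\}=L_{\alpha^\#}\beta-L_{\beta^\#}\alpha-d(\Lambda(\alpha,\beta))$, and let $H^k_\Lambda(M)$ be its cohomology. Put $\mathcal V_{p,q}(M)=\Gamma(\Lambda^qTF\otimes\Lambda^p\nu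 F)$ and let $\Omega_{p,q}(M)$ be the forms of degree $p+q$ with $p$ transversal and $q$ tangential arguments. Let $\sigma''$ be the part of type $(0,1)$ of $\sigma$ and $d''$ the part of type $(0,1)$ of $d$. The tangential Poisson cohomology is $H^q_{\Lambda,\mathrm{tan}}(M)=H^q(\mathcal V_{0,\bullet}(M),\sigma'')$, and $H^q(M,P^p(F))=H^q(\Omega_{p,\bullet}(M),d'')$. Let $\sigma(\mathcal V_{1,0}(M))\subset H^2_{\Lambda,\mathrm{tan}}(M)$ denote the subspace of the classes of those bivector fields $\sigma(V)$, $V\in\mathcal V_{1,0}(M)$, that lie in $\mathcal V_{0,2}(M)$. Let $I(M)$ be the algebra of Casimir functions of $\Lambda$, that is, of the functions with trivial Hamiltonian vector field. Then: (i) there are an isomorphism of real vector spaces $$H^2_\Lambda(M)\;\cong\;\frac{H^2_{\Lambda,\mathrm{tan}}(M)}{\sigma(\mathcal V_{1,0}(M))}\;\oplus\;H^1(M,P^1(F))$$ and an isomorphism of $I(M)$-modules $$H^3_\Lambda(M)\;\cong\;H^2(M,P^1(F));$$ (ii) $H^q_{\Lambda,\mathrm{tan}}(M)\cong H^q(M,P^1(F))$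 as $I(M)$-modules, for all $q\ge 0$. -/

import Mathlib

open scoped Manifold ContDiff

noncomputable section

namespace PoissonGeom

/-- A bracket on an `A`-module `L` which is biadditive, skew-symmetric and satisfies the Leibniz rule
`[a, f b] = f [a, b] + (ρ(a) f) b` for a linear anchor `ρ` with values in the derivations of `A`.
It is used for two concrete brackets only, both constructed below: the Lie bracket of vector fields
and the bracket of 1-forms of a Poisson structure. These three properties are what makes the usual
formula for the differential define an operator on alternating `A`-multilinear maps. -/
structure AnchoredBracket (A L : Type*) [CommRing A] [Algebra ℝ A] [AddCommGroup L]
    [Module A L] where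
  anchor : L →ₗ[A] Derivation ℝ A A
  bracket : L → L → L
  bracket_add : ∀ a b c, bracket a (b + c) = bracket a b + bracket a c
  bracket_skew : ∀ a b, bracket a b = -bracket b a
  bracket_smul : ∀ a (f : A) b, bracket a (f • b) = f • bracket a b + anchor a f • b

namespace AnchoredBracket
variable {A L : Type*} [CommRing A] [Algebra ℝ A] [AddCommGroup L] [Module A L]
  (B : AnchoredBracket A L) {k : ℕ}

lemma add_bracket (a b c : L) : B.bracket (a + b) c = B.bracket a c + B.bracket b c := by
  rw [B.bracket_skew, B.bracket_add, neg_add, ← B.bracket_skew, ← B.bracket_skew]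

lemma smul_bracket (f : A) (a b : L) :
    B.bracket (f • a) b = f • B.bracket a b - B.anchor b f • a := by
  rw [B.bracket_skew, B.bracket_smul, B.bracket_skew b a]
  simp [sub_eq_add_neg, add_comm]

/-- The value on `v = (v₀, …, v_k)` of the differential of a `k`-cochain `Q`:
`∑_j (-1)^j ρ(v_j) (Q(…, v̂_j, …)) + ∑_{i<j} (-1)^j Q(…, [v_i, v_j], …, v̂_j, …)`,
where in the second sum `[v_i, v_j]` stands in the slot of `v_i`. Moving the bracket to the first slot
gives the sign `(-1)^(i+j)` of the usual formula
`∑_{i<j} (-1)^(i+j) Q([v_i, v_j], v₀, …, v̂_i, …, v̂_j, …, v_k)`. -/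
def differentialFun (Q : L [⋀^Fin k]→ₗ[A] A) (v : Fin (k + 1) → L) : A :=
  ∑ j : Fin (k + 1), (-1) ^ (j : ℕ) * B.anchor (v j) (Q (j.removeNth v)) +
    ∑ j : Fin (k + 1), ∑ i ∈ Finset.Iio j,
      (-1) ^ (j : ℕ) * Q (j.removeNth (Function.update v i (B.bracket (v i) (v j))))

lemma swap_term (Q : L [⋀^Fin k]→ₗ[A] A) (v : Fin (k + 1) → L) (i j : Fin (k + 1)) (h : i ≠ j)
    (b : L) :
    (-1) ^ (i : ℕ) * Q (i.removeNth (Function.update v j b)) =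
      -((-1) ^ (j : ℕ) * Q (j.removeNth (Function.update v i b))) := by
  have h1 := Q.neg_one_pow_smul_map_removeNth_add_eq_zero_of_eq
    (v := Function.update (Function.update v i b) j b) (i := i) (j := j)
    (by simp [Function.update_of_ne h]) h
  have h2 : i.removeNth (Function.update (Function.update v i b) j b) =
      i.removeNth (Function.update v j b) := by
    rw [Function.update_comm h, Fin.removeNth_update]
  rw [Fin.removeNth_update, h2] at h1
  rw [eq_neg_iff_add_eq_zero, ← h1]
  simp [zsmul_eq_mul]

/-- The term of the second sum of the differential belonging to the pair `(i, j)`. -/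
def pairTerm (Q : L [⋀^Fin k]→ₗ[A] A) (v : Fin (k + 1) → L) (j i : Fin (k + 1)) : A :=
  (-1) ^ (j : ℕ) * Q (j.removeNth (Function.update v i (B.bracket (v i) (v j))))


lemma slot_add (Q : L [⋀^Fin k]→ₗ[A] A) (v : Fin (k + 1) → L) {i j : Fin (k + 1)} (h : i ≠ j)
    (x y : L) :
    Q (j.removeNth (Function.update v i (x + y))) =
      Q (j.removeNth (Function.update v i x)) + Q (j.removeNth (Function.update v i y)) := by
  obtain ⟨m, rfl⟩ := Fin.exists_succAbove_eq h
  simp only [Fin.removeNth_update_succAbove, AlternatingMap.map_update_add]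

lemma slot_smul (Q : L [⋀^Fin k]→ₗ[A] A) (v : Fin (k + 1) → L) {i j : Fin (k + 1)} (h : i ≠ j)
    (f : A) (x : L) :
    Q (j.removeNth (Function.update v i (f • x))) =
      f * Q (j.removeNth (Function.update v i x)) := by
  obtain ⟨m, rfl⟩ := Fin.exists_succAbove_eq h
  simp only [Fin.removeNth_update_succAbove, AlternatingMap.map_update_smul, smul_eq_mul]

lemma slot_eq_zero (Q : L [⋀^Fin k]→ₗ[A] A) (v : Fin (k + 1) → L) {a b j : Fin (k + 1)}
    (hab : a ≠ b) (ha : a ≠ j) (hb : b ≠ j) (h : v a = v b) : Q (j.removeNth v) = 0 := by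
  obtain ⟨m, rfl⟩ := Fin.exists_succAbove_eq ha
  obtain ⟨n, rfl⟩ := Fin.exists_succAbove_eq hb
  exact Q.map_eq_zero_of_eq _ h (fun h => hab (by rw [h]))

lemma pairTerm_comm (Q : L [⋀^Fin k]→ₗ[A] A) (v : Fin (k + 1) → L) (i j : Fin (k + 1))
    (h : i ≠ j) : B.pairTerm Q v j i = B.pairTerm Q v i j := by
  unfold pairTerm
  rw [swap_term Q v j i h.symm, B.bracket_skew (v i) (v j), ← neg_one_smul A (B.bracket _ _),
    slot_smul Q v h.symm]
  ring

lemma two_mul_differentialFun (Q : L [⋀^Fin k]→ₗ[A] A) (v : Fin (k + 1) → L) :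
    2 * B.differentialFun Q v =
      ∑ j : Fin (k + 1), (2 * ((-1) ^ (j : ℕ) * B.anchor (v j) (Q (j.removeNth v))) +
        ∑ i ∈ Finset.univ.erase j, B.pairTerm Q v j i) := by
  have h : ∀ j : Fin (k + 1), ∑ i ∈ Finset.univ.erase j, B.pairTerm Q v j i =
      ∑ i ∈ Finset.Iio j, B.pairTerm Q v j i + ∑ i ∈ Finset.Ioi j, B.pairTerm Q v j i := by
    intro j
    rw [← Finset.sum_union]
    · congr 1; ext i; simp [lt_or_lt_iff_ne]
    · rw [Finset.disjoint_left]; intro i; simp only [Finset.mem_Iio, Finset.mem_Ioi]; omega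
  have h2 : ∑ j : Fin (k + 1), ∑ i ∈ Finset.Ioi j, B.pairTerm Q v j i =
      ∑ j : Fin (k + 1), ∑ i ∈ Finset.Iio j, B.pairTerm Q v j i := by
    rw [Finset.sum_comm' (t' := Finset.univ) (s' := fun i => Finset.Iio i) (by simp)]
    refine Finset.sum_congr rfl fun i _ => Finset.sum_congr rfl fun j hj => ?_
    exact B.pairTerm_comm Q v i j (Finset.mem_Iio.1 hj).ne'
  rw [Finset.sum_add_distrib, ← Finset.mul_sum, Finset.sum_congr rfl fun j _ => h j,
    Finset.sum_add_distrib, h2, differentialFun]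
  simp only [pairTerm]
  ring

lemma eq_of_two_mul {x y : A} (h : 2 * x = 2 * y) : x = y := by
  have h2 : algebraMap ℝ A (1 / 2) * 2 = 1 := by
    rw [← map_ofNat (algebraMap ℝ A) 2, ← map_mul]; norm_num
  calc x = algebraMap ℝ A (1 / 2) * (2 * x) := by rw [← mul_assoc, h2, one_mul]
    _ = algebraMap ℝ A (1 / 2) * (2 * y) := by rw [h]
    _ = y := by rw [← mul_assoc, h2, one_mul]

lemma pairTerm_update_left (Q : L [⋀^Fin k]→ₗ[A] A) (v : Fin (k + 1) → L) {i j : Fin (k + 1)}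
    (h : i ≠ j) (z : L) : B.pairTerm Q (Function.update v j z) j i =
      (-1) ^ (j : ℕ) * Q (j.removeNth (Function.update v i (B.bracket (v i) z))) := by
  simp only [pairTerm, Function.update_self, Function.update_of_ne h]
  rw [Function.update_comm h.symm, Fin.removeNth_update]

lemma pairTerm_update_right (Q : L [⋀^Fin k]→ₗ[A] A) (v : Fin (k + 1) → L) {i j : Fin (k + 1)}
    (h : i ≠ j) (z : L) : B.pairTerm Q (Function.update v i z) j i =
      (-1) ^ (j : ℕ) * Q (j.removeNth (Function.update v i (B.bracket z (v j)))) := by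
  simp only [pairTerm, Function.update_self, Function.update_of_ne h.symm, Function.update_idem]

lemma pairTerm_update_of_ne (Q : L [⋀^Fin k]→ₗ[A] A) (v : Fin (k + 1) → L)
    {a i j : Fin (k + 1)} (hi : a ≠ i) (hj : a ≠ j) (z : L) :
    B.pairTerm Q (Function.update v a z) j i = (-1) ^ (j : ℕ) *
      Q (j.removeNth (Function.update (Function.update v i (B.bracket (v i) (v j))) a z)) := by
  simp only [pairTerm, Function.update_of_ne hi.symm, Function.update_of_ne hj.symm]
  rw [Function.update_comm hi]

lemma differentialFun_update_add (Q : L [⋀^Fin k]→ₗ[A] A) (v : Fin (k + 1) → L)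
    (a : Fin (k + 1)) (x y : L) :
    B.differentialFun Q (Function.update v a (x + y)) =
      B.differentialFun Q (Function.update v a x) + B.differentialFun Q (Function.update v a y) := by
  apply eq_of_two_mul
  rw [mul_add, two_mul_differentialFun, two_mul_differentialFun, two_mul_differentialFun,
    ← Finset.sum_add_distrib]
  refine Finset.sum_congr rfl fun j _ => ?_
  have h1 : B.anchor (Function.update v a (x + y) j)
        (Q (j.removeNth (Function.update v a (x + y)))) =
      B.anchor (Function.update v a x j) (Q (j.removeNth (Function.update v a x))) +
      B.anchor (Function.update v a y j) (Q (j.removeNth (Function.update v a y))) := by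
    rcases eq_or_ne a j with rfl | h
    · simp
    · simp [slot_add Q v h, Function.update_of_ne h.symm]
  have h2 : ∀ i ∈ Finset.univ.erase j, B.pairTerm Q (Function.update v a (x + y)) j i =
      B.pairTerm Q (Function.update v a x) j i + B.pairTerm Q (Function.update v a y) j i := by
    intro i hi
    have hij : i ≠ j := Finset.ne_of_mem_erase hi
    rcases eq_or_ne a j with rfl | hj
    · simp only [pairTerm_update_left _ _ _ hij, bracket_add, slot_add Q v hij, mul_add]
    · rcases eq_or_ne a i with rfl | hi
      · simp only [pairTerm_update_right _ _ _ hij, add_bracket, slot_add Q v hij, mul_add]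
      · simp only [pairTerm_update_of_ne _ _ _ hi hj, slot_add Q _ hj, mul_add]
  rw [h1, Finset.sum_congr rfl h2, Finset.sum_add_distrib]
  ring

lemma differentialFun_update_smul (Q : L [⋀^Fin k]→ₗ[A] A) (v : Fin (k + 1) → L)
    (a : Fin (k + 1)) (f : A) (x : L) :
    B.differentialFun Q (Function.update v a (f • x)) =
      f * B.differentialFun Q (Function.update v a x) := by
  apply eq_of_two_mul
  rw [mul_left_comm, two_mul_differentialFun, two_mul_differentialFun,
    ← Finset.add_sum_erase _ _ (Finset.mem_univ a), ← Finset.add_sum_erase _ _ (Finset.mem_univ a)]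
  -- the Leibniz defect of the slot `a`
  have ha : ∑ i ∈ Finset.univ.erase a, B.pairTerm Q (Function.update v a (f • x)) a i =
      f * ∑ i ∈ Finset.univ.erase a, B.pairTerm Q (Function.update v a x) a i +
      ∑ i ∈ Finset.univ.erase a, B.anchor (v i) f *
        ((-1) ^ (a : ℕ) * Q (a.removeNth (Function.update v i x))) := by
    rw [Finset.mul_sum, ← Finset.sum_add_distrib]
    refine Finset.sum_congr rfl fun i hi => ?_
    have hia : i ≠ a := Finset.ne_of_mem_erase hi
    rw [pairTerm_update_left _ _ _ hia, pairTerm_update_left _ _ _ hia, bracket_smul,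
      slot_add Q v hia, slot_smul Q v hia, slot_smul Q v hia]
    ring
  have hj : ∀ j ∈ Finset.univ.erase a,
      2 * ((-1) ^ (j : ℕ) * B.anchor (Function.update v a (f • x) j)
        (Q (j.removeNth (Function.update v a (f • x))))) +
        ∑ i ∈ Finset.univ.erase j, B.pairTerm Q (Function.update v a (f • x)) j i =
      f * (2 * ((-1) ^ (j : ℕ) * B.anchor (Function.update v a x j)
        (Q (j.removeNth (Function.update v a x)))) +
        ∑ i ∈ Finset.univ.erase j, B.pairTerm Q (Function.update v a x) j i) -
      B.anchor (v j) f * ((-1) ^ (a : ℕ) * Q (a.removeNth (Function.update v j x))) := by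
    intro j hj
    have hja : j ≠ a := Finset.ne_of_mem_erase hj
    have hmem : a ∈ Finset.univ.erase j := Finset.mem_erase.2 ⟨hja.symm, Finset.mem_univ _⟩
    rw [swap_term Q v a j hja.symm x]
    rw [← Finset.add_sum_erase _ _ hmem, ← Finset.add_sum_erase _ _ hmem]
    have h3 : ∑ i ∈ (Finset.univ.erase j).erase a,
          B.pairTerm Q (Function.update v a (f • x)) j i =
        f * ∑ i ∈ (Finset.univ.erase j).erase a, B.pairTerm Q (Function.update v a x) j i := by
      rw [Finset.mul_sum]
      refine Finset.sum_congr rfl fun i hi => ?_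
      have hia : a ≠ i := (Finset.ne_of_mem_erase hi).symm
      rw [pairTerm_update_of_ne _ _ _ hia hja.symm, pairTerm_update_of_ne _ _ _ hia hja.symm,
        slot_smul Q _ hja.symm]
      ring
    rw [h3, pairTerm_update_right _ _ _ hja.symm, pairTerm_update_right _ _ _ hja.symm,
      smul_bracket, sub_eq_add_neg, ← neg_smul, slot_add Q v hja.symm, slot_smul Q v hja.symm,
      slot_smul Q v hja.symm, slot_smul Q v hja.symm, Function.update_of_ne hja,
      Function.update_of_ne hja, Derivation.leibniz]
    simp only [smul_eq_mul]
    ring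
  rw [ha, Finset.sum_congr rfl hj, Finset.sum_sub_distrib, ← Finset.mul_sum]
  simp only [Function.update_self, map_smul, Fin.removeNth_update, Derivation.smul_apply,
    smul_eq_mul]
  ring

lemma differentialFun_eq_zero (Q : L [⋀^Fin k]→ₗ[A] A) (v : Fin (k + 1) → L)
    {a b : Fin (k + 1)} (h : v a = v b) (hab : a ≠ b) : B.differentialFun Q v = 0 := by
  apply eq_of_two_mul
  rw [mul_zero, two_mul_differentialFun]
  have hb : b ∈ Finset.univ.erase a := Finset.mem_erase.2 ⟨hab.symm, Finset.mem_univ _⟩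
  have ha : a ∈ Finset.univ.erase b := Finset.mem_erase.2 ⟨hab, Finset.mem_univ _⟩
  have key : ∀ w : Fin (k + 1) → L, w a = w b →
      (-1) ^ (a : ℕ) * Q (a.removeNth w) = -((-1) ^ (b : ℕ) * Q (b.removeNth w)) := by
    intro w hw
    have := swap_term Q w a b hab (w b)
    rw [Function.update_eq_self] at this
    rw [this, ← hw, Function.update_eq_self]
  rw [← Finset.add_sum_erase _ _ (Finset.mem_univ a),
    ← Finset.add_sum_erase _ (fun j : Fin (k + 1) => 2 * ((-1) ^ (j : ℕ) * B.anchor (v j) (Q (j.removeNth v))) +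
        ∑ i ∈ Finset.univ.erase j, B.pairTerm Q v j i) hb,
    Finset.sum_eq_zero (s := (Finset.univ.erase a).erase b), add_zero,
    ← Finset.add_sum_erase _ _ hb, ← Finset.add_sum_erase _ _ ha]
  · have h1 : ∑ i ∈ (Finset.univ.erase a).erase b, B.pairTerm Q v a i =
        -∑ i ∈ (Finset.univ.erase b).erase a, B.pairTerm Q v b i := by
      rw [Finset.erase_right_comm, ← Finset.sum_neg_distrib]
      refine Finset.sum_congr rfl fun i hi => ?_
      have hia : i ≠ a := Finset.ne_of_mem_erase hi
      have hib : i ≠ b := Finset.ne_of_mem_erase (Finset.mem_of_mem_erase hi)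
      unfold pairTerm
      rw [key _ (by rw [Function.update_of_ne hia.symm, Function.update_of_ne hib.symm, h]), h]
    have h2 : (-1) ^ (a : ℕ) * B.anchor (v a) (Q (a.removeNth v)) =
        -((-1) ^ (b : ℕ) * B.anchor (v b) (Q (b.removeNth v))) := by
      have := congrArg (B.anchor (v b)) (key v h)
      rw [map_neg, Derivation.leibniz, Derivation.leibniz] at this
      simpa [Derivation.leibniz_pow, h] using this
    have h3 : B.pairTerm Q v a b = -B.pairTerm Q v b a := by
      unfold pairTerm
      rw [swap_term Q v a b hab, h]
    rw [h1, h2, h3]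
    ring
  · intro j hj
    have hjb : b ≠ j := (Finset.ne_of_mem_erase hj).symm
    have hja : a ≠ j := (Finset.ne_of_mem_erase (Finset.mem_of_mem_erase hj)).symm
    have ma : a ∈ Finset.univ.erase j := Finset.mem_erase.2 ⟨hja, Finset.mem_univ _⟩
    have mb : b ∈ (Finset.univ.erase j).erase a :=
      Finset.mem_erase.2 ⟨hab.symm, Finset.mem_erase.2 ⟨hjb, Finset.mem_univ _⟩⟩
    rw [slot_eq_zero Q v hab hja hjb h, map_zero, mul_zero, mul_zero, zero_add,
      ← Finset.add_sum_erase _ _ ma, ← Finset.add_sum_erase _ _ mb, Finset.sum_eq_zero, add_zero]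
    · -- exchanging the two equal entries changes the sign
      obtain ⟨m, rfl⟩ := Fin.exists_succAbove_eq hja
      obtain ⟨n, rfl⟩ := Fin.exists_succAbove_eq hjb
      have hmn : m ≠ n := fun h => hab (by rw [h])
      unfold pairTerm
      rw [Fin.removeNth_update_succAbove, Fin.removeNth_update_succAbove, ← mul_add]
      have e : j.removeNth v m = j.removeNth v n := h
      have := Q.map_swap (Function.update (j.removeNth v) m
        (B.bracket (v (j.succAbove m)) (v j))) hmn
      have e2 : Function.update (j.removeNth v) m (B.bracket (v (j.succAbove m)) (v j)) ∘
          Equiv.swap m n = Function.update (j.removeNth v) n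
            (B.bracket (v (j.succAbove n)) (v j)) := by
        funext i
        rcases eq_or_ne i m with rfl | him
        · simp [Function.update_of_ne hmn.symm, Function.update_of_ne hmn, e]
        · rcases eq_or_ne i n with rfl | hin
          · simp [h]
          · simp [Equiv.swap_apply_of_ne_of_ne him hin, him, hin]
      rw [e2] at this
      rw [this, add_neg_cancel, mul_zero]
    · intro i hi
      have hib : i ≠ b := Finset.ne_of_mem_erase hi
      have hia : i ≠ a := Finset.ne_of_mem_erase (Finset.mem_of_mem_erase hi)
      unfold pairTerm
      rw [slot_eq_zero Q _ hab hja hjb, mul_zero]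
      rw [Function.update_of_ne hia.symm, Function.update_of_ne hib.symm, h]

/-- The differential as an additive operator from `k`-cochains to `(k + 1)`-cochains. -/
def differential (k : ℕ) : (L [⋀^Fin k]→ₗ[A] A) →+ (L [⋀^Fin (k + 1)]→ₗ[A] A) where
  toFun Q :=
    { toFun := B.differentialFun Q
      map_update_add' := by
        intro inst v a x y
        cases Subsingleton.elim inst (instDecidableEqFin _)
        exact B.differentialFun_update_add Q v a x y
      map_update_smul' := by
        intro inst v a f x
        cases Subsingleton.elim inst (instDecidableEqFin _)
        exact B.differentialFun_update_smul Q v a f x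
      map_eq_zero_of_eq' := fun v _ _ h hab => B.differentialFun_eq_zero Q v h hab }
  map_zero' := by
    ext v; simp [differentialFun]
  map_add' Q R := by
    ext v
    simp [differentialFun, mul_add, Finset.sum_add_distrib]
    ring

@[simp] lemma differential_apply (Q : L [⋀^Fin k]→ₗ[A] A) (v : Fin (k + 1) → L) :
    B.differential k Q v = B.differentialFun Q v := rfl

lemma differentialFun_smul (f : A) (Q : L [⋀^Fin k]→ₗ[A] A) (v : Fin (k + 1) → L) :
    B.differentialFun (f • Q) v = f * B.differentialFun Q v +
      ∑ j : Fin (k + 1), (-1) ^ (j : ℕ) * (B.anchor (v j) f * Q (j.removeNth v)) := by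
  simp only [differentialFun, AlternatingMap.smul_apply, smul_eq_mul, Derivation.leibniz, mul_add,
    Finset.mul_sum, Finset.sum_add_distrib]
  have h1 : ∀ j : Fin (k + 1), (-1) ^ (j : ℕ) * (Q (j.removeNth v) * B.anchor (v j) f) =
    (-1) ^ (j : ℕ) * (B.anchor (v j) f * Q (j.removeNth v)) := fun j => by ring
  simp only [mul_left_comm f, h1]
  ring
end AnchoredBracket


section Cohomology

variable {R : Type*} [CommRing R] {C : ℕ → Type*} [∀ k, AddCommGroup (C k)] [∀ k, Module R (C k)]

/-- The coboundaries of degree `k`; there are none but `0` in degree `0`. -/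
def coboundaries (d : ∀ k, C k →ₗ[R] C (k + 1)) : ∀ k, Submodule R (C k)
  | 0 => ⊥
  | k + 1 => LinearMap.range (d k)

/-- The cohomology `Ker d_k / Im d_{k-1}` of a sequence of linear maps, in degree `k`. -/
def Cohomology (d : ∀ k, C k →ₗ[R] C (k + 1)) (k : ℕ) : Type _ :=
  LinearMap.ker (d k) ⧸ (coboundaries d k).submoduleOf (LinearMap.ker (d k))

namespace Cohomology
variable (d : ∀ k, C k →ₗ[R] C (k + 1)) (k : ℕ)

instance : AddCommGroup (Cohomology d k) :=
  inferInstanceAs (AddCommGroup (LinearMap.ker (d k) ⧸ _))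

instance : Module R (Cohomology d k) :=
  inferInstanceAs (Module R (LinearMap.ker (d k) ⧸ _))

/-- The class of a cocycle. -/
def mk : LinearMap.ker (d k) →ₗ[R] Cohomology d k :=
  Submodule.mkQ ((coboundaries d k).submoduleOf (LinearMap.ker (d k)))

/-- The cohomology classes that have a representative cocycle in `W`. -/
def classesIn (W : Submodule R (C k)) : Submodule R (Cohomology d k) :=
  (W.submoduleOf (LinearMap.ker (d k))).map (mk d k)

instance [Algebra ℝ R] : Module ℝ (Cohomology d k) := Module.compHom _ (algebraMap ℝ R)

instance [Algebra ℝ R] : IsScalarTower ℝ R (Cohomology d k) :=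
  IsScalarTower.of_algebraMap_smul fun _ _ => rfl

end Cohomology

end Cohomology


section Bigrading
variable {A L : Type*} [CommRing A] [AddCommGroup L] [Module A L] {T N : Submodule A L}

/-- The alternating `k`-linear maps of type `(p, k - p)` for the decomposition `L = T ⊕ N`: those which
vanish on all families of homogeneous arguments (each in `T` or in `N`) in which the number of
arguments taken from `N` is not `p`. -/
def ofType (T N : Submodule A L) (p k : ℕ) : Submodule A (L [⋀^Fin k]→ₗ[A] A) where
  carrier := {θ | ∀ (v : Fin k → L) (S : Finset (Fin k)),
    (∀ i ∈ S, v i ∈ N) → (∀ i ∉ S, v i ∈ T) → S.card ≠ p → θ v = 0}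
  add_mem' := fun h₁ h₂ v S hN hT hS => by
    rw [AlternatingMap.add_apply, h₁ v S hN hT hS, h₂ v S hN hT hS, add_zero]
  zero_mem' := fun _ _ _ _ _ => rfl
  smul_mem' := fun f θ h v S hN hT hS => by
    rw [AlternatingMap.smul_apply, h v S hN hT hS, smul_zero]

/-- The arguments `v i`, projected to `N` along `T` for `i ∈ S` and to `T` along `N` for `i ∉ S`. -/
def splitArgs (h : IsCompl T N) {k : ℕ} (S : Finset (Fin k)) (v : Fin k → L) : Fin k → L :=
  fun i => if i ∈ S then N.projection T h.symm (v i) else T.projection N h (v i)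

lemma splitArgs_update (h : IsCompl T N) {k : ℕ} (S : Finset (Fin k)) (v : Fin k → L)
    (a : Fin k) (x : L) : splitArgs h S (Function.update v a x) =
      Function.update (splitArgs h S v) a
        (if a ∈ S then N.projection T h.symm x else T.projection N h x) := by
  funext i
  rcases eq_or_ne i a with rfl | hi
  · simp [splitArgs]
  · simp [splitArgs, hi]

lemma sum_splitArgs_eq_zero (h : IsCompl T N) (p : ℕ) {k : ℕ} (θ : L [⋀^Fin k]→ₗ[A] A)
    (v : Fin k → L) {a b : Fin k} (hv : v a = v b) (hab : a ≠ b) :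
    ∑ S ∈ Finset.powersetCard p Finset.univ, θ (splitArgs h S v) = 0 := by
  have hpre : ∀ (S : Finset (Fin k)) (i : Fin k),
      i ∈ S.map (Equiv.swap a b).toEmbedding ↔ Equiv.swap a b i ∈ S := by
    intro S i; rw [Finset.mem_map_equiv, Equiv.symm_swap]
  have hsw : ∀ S : Finset (Fin k), splitArgs h (S.map (Equiv.swap a b).toEmbedding) v =
      splitArgs h S v ∘ Equiv.swap a b := by
    intro S
    funext i
    have : v (Equiv.swap a b i) = v i := by
      rcases eq_or_ne i a with rfl | hia
      · simp [hv]
      · rcases eq_or_ne i b with rfl | hib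
        · simp [hv]
        · rw [Equiv.swap_apply_of_ne_of_ne hia hib]
    simp only [splitArgs, Function.comp, hpre, this]
  refine Finset.sum_involution (fun S _ => S.map (Equiv.swap a b).toEmbedding) ?_ ?_ ?_ ?_
  · intro S _
    rw [hsw, θ.map_swap _ hab, add_neg_cancel]
  · intro S _ hne hS
    apply hne
    refine θ.map_eq_zero_of_eq _ ?_ hab
    have : (a ∈ S) ↔ (b ∈ S) := by
      conv_lhs => rw [← hS, hpre, Equiv.swap_apply_left]
    simp only [splitArgs, this, hv]
  · intro S hS
    simpa using hS
  · intro S _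
    ext i
    simp

/-- The component of type `(p, k - p)` of an alternating map for the decomposition `L = T ⊕ N`:
`v ↦ ∑_S θ(v_S)`, where `S` runs over the `p`-element sets of slots and `v_S` has the entries with
index in `S` projected to `N` and the others projected to `T`. -/
def component (h : IsCompl T N) (p k : ℕ) :
    (L [⋀^Fin k]→ₗ[A] A) →ₗ[A] (L [⋀^Fin k]→ₗ[A] A) where
  toFun θ :=
    { toFun := fun v => ∑ S ∈ Finset.powersetCard p Finset.univ, θ (splitArgs h S v)
      map_update_add' := by
        intro inst v a x y
        cases Subsingleton.elim inst (instDecidableEqFin _)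
        rw [← Finset.sum_add_distrib]
        refine Finset.sum_congr rfl fun S _ => ?_
        simp only [splitArgs_update]
        split_ifs <;> rw [map_add, AlternatingMap.map_update_add]
      map_update_smul' := by
        intro inst v a f x
        cases Subsingleton.elim inst (instDecidableEqFin _)
        rw [Finset.smul_sum]
        refine Finset.sum_congr rfl fun S _ => ?_
        simp only [splitArgs_update]
        split_ifs <;> rw [map_smul, AlternatingMap.map_update_smul]
      map_eq_zero_of_eq' := fun v _ _ hv hab => sum_splitArgs_eq_zero h p θ v hv hab }
  map_add' θ η := by ext v; simp [Finset.sum_add_distrib]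
  map_smul' f θ := by ext v; simp [Finset.mul_sum]

lemma component_apply (h : IsCompl T N) (p k : ℕ) (θ : L [⋀^Fin k]→ₗ[A] A) (v : Fin k → L) :
    component h p k θ v = ∑ S ∈ Finset.powersetCard p Finset.univ, θ (splitArgs h S v) := rfl

lemma splitArgs_mem_right (h : IsCompl T N) {k : ℕ} {S : Finset (Fin k)} (v : Fin k → L)
    {i : Fin k} (hi : i ∈ S) : splitArgs h S v i ∈ N := by
  rw [splitArgs, if_pos hi]; exact Submodule.projection_apply_mem _ _

lemma splitArgs_mem_left (h : IsCompl T N) {k : ℕ} {S : Finset (Fin k)} (v : Fin k → L)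
    {i : Fin k} (hi : i ∉ S) : splitArgs h S v i ∈ T := by
  rw [splitArgs, if_neg hi]; exact Submodule.projection_apply_mem _ _

lemma component_mem (h : IsCompl T N) (p k : ℕ) (θ : L [⋀^Fin k]→ₗ[A] A) :
    component h p k θ ∈ ofType T N p k := by
  intro v S hN hT hS
  rw [component_apply]
  refine Finset.sum_eq_zero fun R hR => ?_
  have hRS : ¬ (R = S) := by
    rintro rfl; exact hS (Finset.mem_powersetCard.1 hR).2
  obtain ⟨i, hi⟩ : ∃ i, ¬ (i ∈ R ↔ i ∈ S) := by
    by_contra hc; push Not at hc; exact hRS (Finset.ext hc)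
  refine θ.map_coord_zero i ?_
  by_cases hiR : i ∈ R
  · have hiS : i ∉ S := fun hiS => hi ⟨fun _ => hiS, fun _ => hiR⟩
    rw [splitArgs, if_pos hiR, Submodule.projection_apply_eq_zero_iff]
    exact hT i hiS
  · have hiS : i ∈ S := by_contra fun hiS => hi ⟨fun x => (hiR x).elim, fun x => (hiS x).elim⟩
    rw [splitArgs, if_neg hiR, Submodule.projection_apply_eq_zero_iff]
    exact hN i hiS

variable [Algebra ℝ A]

lemma component_differential_smul (B : AnchoredBracket A L) (h : IsCompl T N) {p k : ℕ} {f : A}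
    (hf : ∀ a ∈ T, B.anchor a f = 0) {θ : L [⋀^Fin k]→ₗ[A] A} (hθ : θ ∈ ofType T N p k) :
    component h p (k + 1) (B.differential k (f • θ)) =
      f • component h p (k + 1) (B.differential k θ) := by
  ext v
  rw [AlternatingMap.smul_apply, component_apply, component_apply, Finset.smul_sum]
  refine Finset.sum_congr rfl fun S hS => ?_
  rw [AnchoredBracket.differential_apply, AnchoredBracket.differential_apply,
    AnchoredBracket.differentialFun_smul, smul_eq_mul, add_eq_left]
  refine Finset.sum_eq_zero fun j _ => ?_
  by_cases hj : j ∈ S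
  · have hcard : (Finset.univ.filter fun i => j.succAbove i ∈ S).card ≠ p := by
      have h1 : (Finset.univ.filter fun i => j.succAbove i ∈ S).map (Fin.succAboveEmb j)
          = S.erase j := by
        ext i
        simp only [Finset.mem_map, Finset.mem_filter, Finset.mem_univ, true_and,
          Finset.mem_erase]
        constructor
        · rintro ⟨m, hm, rfl⟩
          exact ⟨Fin.succAbove_ne j m, hm⟩
        · rintro ⟨hij, hi⟩
          obtain ⟨m, rfl⟩ := Fin.exists_succAbove_eq hij
          exact ⟨m, hi, rfl⟩
      have h2 := congrArg Finset.card h1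
      rw [Finset.card_map, Finset.card_erase_of_mem hj] at h2
      have h3 := (Finset.mem_powersetCard.1 hS).2
      have h4 := Finset.card_pos.2 ⟨j, hj⟩
      omega
    rw [hθ _ (Finset.univ.filter fun i => j.succAbove i ∈ S) ?_ ?_ hcard, mul_zero, mul_zero]
    · intro i hi
      exact splitArgs_mem_right h v (Finset.mem_filter.1 hi).2
    · intro i hi
      exact splitArgs_mem_left h v fun hc => hi (Finset.mem_filter.2 ⟨Finset.mem_univ _, hc⟩)
  · rw [hf _ (splitArgs_mem_left h v hj), zero_mul, mul_zero]

instance (p k : ℕ) : AddCommGroup (ofType T N p k) := Submodule.addCommGroup _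

instance (R : Subalgebra ℝ A) (p k : ℕ) : Module R (ofType T N p k) := Submodule.module' _

/-- The leafwise part of the differential: on cochains of type `(p, k - p)`, the component of type
`(p, k + 1 - p)` of the differential. It is linear over functions which are constant along `T`. -/
def leafDifferential (B : AnchoredBracket A L) (h : IsCompl T N) (R : Subalgebra ℝ A)
    (hR : ∀ f ∈ R, ∀ a ∈ T, B.anchor a f = 0) (p k : ℕ) :
    ofType T N p k →ₗ[R] ofType T N p (k + 1) where
  toFun θ := ⟨component h p (k + 1) (B.differential k θ), component_mem h p (k + 1) _⟩
  map_add' θ η := by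
    ext1; simp only [Submodule.coe_add, map_add]
  map_smul' f θ := by
    ext1; exact component_differential_smul B h (hR f f.2) θ.2

/-- The differential on all cochains; it is linear over the functions annihilated by all anchors. -/
def totalDifferential (B : AnchoredBracket A L) (R : Subalgebra ℝ A)
    (hR : ∀ f ∈ R, ∀ a, B.anchor a f = 0) (k : ℕ) :
    (L [⋀^Fin k]→ₗ[A] A) →ₗ[R] (L [⋀^Fin (k + 1)]→ₗ[A] A) where
  toFun := B.differential k
  map_add' := map_add _
  map_smul' f Q := by
    ext1 v
    change B.differentialFun ((f : A) • Q) v = (f : A) * B.differentialFun Q v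
    rw [AnchoredBracket.differentialFun_smul, add_eq_left]
    refine Finset.sum_eq_zero fun j _ => ?_
    rw [hR f f.2, zero_mul, mul_zero]

section
variable (B : AnchoredBracket A L) (h : IsCompl T N) (R : Subalgebra ℝ A)
  (hR : ∀ f ∈ R, ∀ a ∈ T, B.anchor a f = 0) (hR' : ∀ f ∈ R, ∀ a, B.anchor a f = 0)

/-- Cohomology of all cochains with the differential. -/
abbrev TotalCohomology (k : ℕ) : Type _ :=
  Cohomology (C := fun j => L [⋀^Fin j]→ₗ[A] A) (totalDifferential B R hR') k

/-- Cohomology of the cochains of type `(p, •)` with the leafwise part of the differential, in total degree `k`. -/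
abbrev LeafCohomology (p k : ℕ) : Type _ :=
  Cohomology (C := fun j => ofType T N p j) (leafDifferential B h R hR p) k

/-- The cochains of type `(0, k + 1)` that are differentials (full differentials, not only a component
of them) of cochains of type `(1, k - 1)`. -/
def transverseImage (hR' : ∀ f ∈ R, ∀ a, B.anchor a f = 0) (k : ℕ) :
    Submodule R (ofType T N 0 (k + 1)) where
  carrier := {Q | ∃ V ∈ ofType T N 1 k, B.differential k V = Q}
  zero_mem' := ⟨0, Submodule.zero_mem _, map_zero _⟩
  add_mem' := by
    rintro Q S ⟨V, hV, hQ⟩ ⟨W, hW, hS⟩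
    exact ⟨V + W, Submodule.add_mem _ hV hW, (map_add _ V W).trans (congrArg₂ (· + ·) hQ hS)⟩
  smul_mem' := by
    rintro f Q ⟨V, hV, hQ⟩
    exact ⟨(f : A) • V, Submodule.smul_mem _ _ hV,
      ((totalDifferential B R hR' k).map_smul f V).trans (congrArg ((f : A) • ·) hQ)⟩

/-- The leafwise cohomology classes represented by differentials of cochains of type `(1, k - 1)`. -/
def transverseClasses (hR' : ∀ f ∈ R, ∀ a, B.anchor a f = 0) (k : ℕ) :
    Submodule R (LeafCohomology B h R hR 0 (k + 1)) :=
  Cohomology.classesIn (C := fun j => ofType T N 0 j) (leafDifferential B h R hR 0) (k + 1)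
    (transverseImage B R hR' k)

end

end Bigrading


section Geometry
variable (E : Type*) [NormedAddCommGroup E] [NormedSpace ℝ E] [FiniteDimensional ℝ E]
  (M : Type*) [TopologicalSpace M] [ChartedSpace E M] [IsManifold 𝓘(ℝ, E) ∞ M]

/-- The algebra `C^∞(M)` of smooth real functions. -/
abbrev SmoothFunction : Type _ := C^∞⟮𝓘(ℝ, E), M; ℝ⟯

/-- Smooth vector fields, that is smooth sections of the tangent bundle. -/
abbrev SmoothVectorField : Type _ :=
  Cₛ^∞⟮𝓘(ℝ, E); E, (TangentSpace 𝓘(ℝ, E) : M → Type _)⟯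

variable {E M}

instance : SMul (SmoothFunction E M) (SmoothVectorField E M) :=
  ⟨fun f X => ⟨(f : M → ℝ) • (X : ∀ x, TangentSpace 𝓘(ℝ, E) x),
    f.contMDiff.smul_section X.contMDiff⟩⟩

lemma smul_vectorField_apply (f : SmoothFunction E M) (X : SmoothVectorField E M) (x : M) :
    (f • X) x = f x • X x := rfl

instance : Module (SmoothFunction E M) (SmoothVectorField E M) where
  one_smul X := by ext x; exact one_smul _ _
  mul_smul f g X := by ext x; exact mul_smul _ _ _
  smul_zero f := by ext x; exact smul_zero _
  smul_add f X Y := by ext x; exact smul_add _ _ _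
  add_smul f g X := by ext x; exact add_smul _ _ _
  zero_smul X := by ext x; exact zero_smul _ _

lemma mdiffAt_function (f : SmoothFunction E M) (x : M) :
    MDifferentiableAt 𝓘(ℝ, E) 𝓘(ℝ, ℝ) f x :=
  f.contMDiff.mdifferentiable (by simp) x

lemma mdiffAt_vectorField (X : SmoothVectorField E M) (x : M) :
    MDifferentiableAt 𝓘(ℝ, E) (𝓘(ℝ, E).prod 𝓘(ℝ, E))
      (fun y => (Bundle.TotalSpace.mk' E y (X y) : TangentBundle 𝓘(ℝ, E) M)) x :=
  X.contMDiff.mdifferentiable (by simp) x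

/-- The derivative `X(f)` of a function along a vector field. -/
def lieDerivFunction (X : SmoothVectorField E M) (f : SmoothFunction E M) :
    SmoothFunction E M :=
  ⟨fun x => mvfderiv 𝓘(ℝ, E) f x (X x), by
    have h1 : ContMDiff 𝓘(ℝ, E) (𝓘(ℝ, ℝ).prod 𝓘(ℝ, ℝ)) ∞
        (fun x => tangentMap 𝓘(ℝ, E) 𝓘(ℝ, ℝ) f (Bundle.TotalSpace.mk' E x (X x))) :=
      (f.contMDiff.contMDiff_tangentMap (m := ∞) (by simp)).comp X.contMDiff
    exact (contMDiff_snd_tangentBundle_modelSpace ℝ 𝓘(ℝ, ℝ)).comp h1⟩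

lemma lieDerivFunction_apply (X : SmoothVectorField E M) (f : SmoothFunction E M) (x : M) :
    lieDerivFunction X f x = mvfderiv 𝓘(ℝ, E) f x (X x) := rfl

/-- The Lie bracket of vector fields. -/
def lieBracket (X Y : SmoothVectorField E M) : SmoothVectorField E M :=
  ⟨VectorField.mlieBracket 𝓘(ℝ, E) X Y, by
    have : IsManifold 𝓘(ℝ, E) ((⊤ : ℕ∞) + 1) M := by simpa using ‹IsManifold 𝓘(ℝ, E) ∞ M›
    have : IsManifold 𝓘(ℝ, E) (minSmoothness ℝ 2) M := by
      rw [minSmoothness_of_isRCLikeNormedField]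
      exact IsManifold.of_le (n := ∞) (by norm_cast)
    exact ContDiff.mlieBracket_vectorField (n := ⊤) (m := ⊤) X.contMDiff Y.contMDiff (by simp)⟩

lemma lieBracket_apply (X Y : SmoothVectorField E M) (x : M) :
    lieBracket X Y x = VectorField.mlieBracket 𝓘(ℝ, E) X Y x := rfl

/-- A vector field as a derivation of `C^∞(M)`. -/
def toDerivation (X : SmoothVectorField E M) :
    Derivation ℝ (SmoothFunction E M) (SmoothFunction E M) :=
  Derivation.mk'
    { toFun := lieDerivFunction X
      map_add' := fun f g => by
        ext x
        have := mvfderiv_add (mdiffAt_function f x) (mdiffAt_function g x)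
        exact congrArg (fun φ => φ (X x)) this
      map_smul' := fun c f => by
        ext x
        have := mvfderiv_smul (mdifferentiableAt_const (c := c)) (mdiffAt_function f x)
        rw [mvfderiv_const] at this
        refine (congrArg (fun φ => φ (X x)) this).trans ?_
        simp
        exact Or.inl rfl }
    (fun f g => by
        ext x
        have := mvfderiv_mul (mdiffAt_function f x) (mdiffAt_function g x)
        exact congrArg (fun φ => φ (X x)) this)

variable (E M) in
/-- Vector fields with the Lie bracket, acting on functions by derivation. -/
def tangentAlgebroid : AnchoredBracket (SmoothFunction E M) (SmoothVectorField E M) where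
  anchor :=
    { toFun := toDerivation
      map_add' := fun X Y => by
        ext f x; exact map_add (mvfderiv 𝓘(ℝ, E) f x) (X x) (Y x)
      map_smul' := fun f X => by
        ext g x; exact map_smul (mvfderiv 𝓘(ℝ, E) g x) (f x) (X x) }
  bracket := lieBracket
  bracket_add X Y Z := by
    ext x; exact VectorField.mlieBracket_add_right (mdiffAt_vectorField Y x) (mdiffAt_vectorField Z x)
  bracket_skew X Y := by
    ext x; exact VectorField.mlieBracket_swap_apply
  bracket_smul X f Y := by
    ext x
    have := VectorField.mlieBracket_smul_right (V := X) (mdiffAt_function f x) (mdiffAt_vectorField Y x)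
    exact this.trans (add_comm _ _)


lemma anchor_apply (X : SmoothVectorField E M) (f : SmoothFunction E M) :
    (tangentAlgebroid E M).anchor X f = lieDerivFunction X f := rfl

variable (E M) in
/-- Differential forms of degree `k`: alternating `C^∞(M)`-multilinear maps on vector fields. -/
abbrev DifferentialForm (k : ℕ) : Type _ :=
  SmoothVectorField E M [⋀^Fin k]→ₗ[SmoothFunction E M] SmoothFunction E M

variable (E M) in
/-- Differential 1-forms: `C^∞(M)`-linear maps from vector fields to functions. -/
abbrev OneForm : Type _ := Module.Dual (SmoothFunction E M) (SmoothVectorField E M)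

variable (E M) in
/-- Multivector fields of degree `k`: alternating `C^∞(M)`-multilinear maps on 1-forms. -/
abbrev MultivectorField (k : ℕ) : Type _ :=
  OneForm E M [⋀^Fin k]→ₗ[SmoothFunction E M] SmoothFunction E M

variable (E M) in
/-- The exterior derivative of differential forms. -/
def exteriorDerivative (k : ℕ) : DifferentialForm E M k →+ DifferentialForm E M (k + 1) :=
  (tangentAlgebroid E M).differential k

variable (E M) in
/-- Orientability: there is a nowhere vanishing form of top degree. -/
def IsOrientable : Prop :=
  ∃ μ : DifferentialForm E M (Module.finrank ℝ E), ∀ x : M, ∃ X, μ X x ≠ 0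

/-- The differential `df` of a function. -/
def differentialFunction (f : SmoothFunction E M) : OneForm E M where
  toFun X := lieDerivFunction X f
  map_add' X Y := by
    rw [← anchor_apply, map_add]; rfl
  map_smul' g X := by
    rw [← anchor_apply, map_smul]; rfl

lemma differentialFunction_apply (f : SmoothFunction E M) (X : SmoothVectorField E M) :
    differentialFunction f X = lieDerivFunction X f := rfl

lemma differentialFunction_add (f g : SmoothFunction E M) :
    differentialFunction (f + g) = differentialFunction f + differentialFunction g := by
  ext1 X; exact map_add (toDerivation X) f g

lemma differentialFunction_neg (f : SmoothFunction E M) :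
    differentialFunction (-f) = -differentialFunction f := by
  ext1 X; exact map_neg (toDerivation X) f

lemma differentialFunction_mul (f g : SmoothFunction E M) :
    differentialFunction (f * g) = f • differentialFunction g + g • differentialFunction f := by
  ext1 X; exact (toDerivation X).leibniz f g

lemma differentialFunction_algebraMap (c : ℝ) :
    differentialFunction (algebraMap ℝ (SmoothFunction E M) c) = 0 := by
  ext1 X; exact (toDerivation X).map_algebraMap c

/-- The Lie derivative of a 1-form: `(L_X α)(Y) = X(α(Y)) - α([X, Y])`. -/
def lieDerivOneForm (X : SmoothVectorField E M) (α : OneForm E M) : OneForm E M where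
  toFun Y := lieDerivFunction X (α Y) - α (lieBracket X Y)
  map_add' Y Z := by
    have h : lieBracket X (Y + Z) = lieBracket X Y + lieBracket X Z :=
      (tangentAlgebroid E M).bracket_add X Y Z
    rw [h, map_add, map_add, ← anchor_apply, map_add, anchor_apply, anchor_apply]
    abel
  map_smul' f Y := by
    have h : lieBracket X (f • Y) = f • lieBracket X Y + lieDerivFunction X f • Y :=
      (tangentAlgebroid E M).bracket_smul X f Y
    rw [h, map_add, map_smul, map_smul, map_smul, ← anchor_apply, ← anchor_apply, ← anchor_apply,
      smul_eq_mul, Derivation.leibniz]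
    simp only [smul_eq_mul, RingHom.id_apply]
    ring

lemma lieDerivOneForm_apply (X : SmoothVectorField E M) (α : OneForm E M)
    (Y : SmoothVectorField E M) :
    lieDerivOneForm X α Y = lieDerivFunction X (α Y) - α (lieBracket X Y) := rfl

/-- The bracket `{f, g} = dg((df)^#)` of functions determined by a map `#` from 1-forms to vector fields. -/
def functionBracket (sharp : OneForm E M →ₗ[SmoothFunction E M] SmoothVectorField E M)
    (f g : SmoothFunction E M) : SmoothFunction E M :=
  differentialFunction g (sharp (differentialFunction f))

variable (E M) in
/-- A Poisson structure, given by the map `#` with `β(α^#) = Λ(α, β)`: it is `C^∞(M)`-linear, the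
bilinear map `Λ` is alternating (so `Λ` is a bivector field), and the bracket
`{f, g} = Λ(df, dg)` of functions satisfies the Jacobi identity. -/
structure PoissonStructure where
  sharp : OneForm E M →ₗ[SmoothFunction E M] SmoothVectorField E M
  skew : ∀ α : OneForm E M, α (sharp α) = 0
  jacobi : ∀ f g h : SmoothFunction E M,
    functionBracket sharp (functionBracket sharp f g) h +
      functionBracket sharp (functionBracket sharp g h) f +
      functionBracket sharp (functionBracket sharp h f) g = 0

namespace PoissonStructure

variable (P : PoissonStructure E M)

/-- The Poisson bivector `Λ(α, β) = β(α^#)`. -/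
def bivector (α β : OneForm E M) : SmoothFunction E M := β (P.sharp α)

lemma bivector_skew (α β : OneForm E M) : P.bivector α β = -P.bivector β α := by
  have h := P.skew (α + β)
  rw [map_add, map_add, LinearMap.add_apply, LinearMap.add_apply, P.skew, P.skew, zero_add,
    add_zero] at h
  exact eq_neg_of_add_eq_zero_left h

/-- The bracket of 1-forms `{α, β} = L_{α^#} β - L_{β^#} α - d(Λ(α, β))`. -/
def koszulBracket (α β : OneForm E M) : OneForm E M :=
  lieDerivOneForm (P.sharp α) β - lieDerivOneForm (P.sharp β) α -
    differentialFunction (P.bivector α β)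

/-- 1-forms with the bracket above, acting on functions by `α ↦ α^#`. The associated differential of
multivector fields is the operator `σ` of the Poisson structure:
`(σQ)(α₀, …, α_k) = ∑_i (-1)^i α_i^#(Q(…, α̂_i, …)) + ∑_{i<j} (-1)^(i+j) Q({α_i, α_j}, …)`. -/
def cotangentAlgebroid : AnchoredBracket (SmoothFunction E M) (OneForm E M) where
  anchor := (tangentAlgebroid E M).anchor ∘ₗ P.sharp
  bracket := P.koszulBracket
  bracket_add α β γ := by
    ext1 Y
    simp only [koszulBracket, bivector, LinearMap.sub_apply, LinearMap.add_apply,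
      lieDerivOneForm_apply, map_add, differentialFunction_add]
    have h : lieBracket (P.sharp β + P.sharp γ) Y =
        lieBracket (P.sharp β) Y + lieBracket (P.sharp γ) Y :=
      (tangentAlgebroid E M).add_bracket _ _ _
    rw [h]
    simp only [← anchor_apply, map_add, Derivation.add_apply]
    abel
  bracket_skew α β := by
    have h : differentialFunction (P.bivector α β) = -differentialFunction (P.bivector β α) := by
      rw [P.bivector_skew, differentialFunction_neg]
    rw [koszulBracket, koszulBracket, h]
    abel
  bracket_smul α f β := by
    ext1 Y
    have h : lieBracket (f • P.sharp β) Y =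
        f • lieBracket (P.sharp β) Y - lieDerivFunction Y f • P.sharp β :=
      (tangentAlgebroid E M).smul_bracket _ _ _
    have h2 : α (P.sharp β) = -β (P.sharp α) := P.bivector_skew β α
    simp only [koszulBracket, bivector, LinearMap.sub_apply, LinearMap.add_apply,
      LinearMap.smul_apply, lieDerivOneForm_apply, map_smul, differentialFunction_apply, h,
      map_sub, LinearMap.comp_apply, h2]
    simp only [← anchor_apply, map_smul, smul_eq_mul, Derivation.leibniz, Derivation.smul_apply]
    ring

/-- The Casimir functions: those with trivial Hamiltonian vector field. -/
def casimirs : Subalgebra ℝ (SmoothFunction E M) where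
  carrier := {f | P.sharp (differentialFunction f) = 0}
  mul_mem' := fun {f g} hf hg => by
    rw [Set.mem_ofPred_eq] at hf hg ⊢
    rw [differentialFunction_mul, map_add, map_smul, map_smul, hf, hg, smul_zero, smul_zero,
      add_zero]
  add_mem' := fun {f g} hf hg => by
    rw [Set.mem_ofPred_eq] at hf hg ⊢
    rw [differentialFunction_add, map_add, hf, hg, add_zero]
  algebraMap_mem' := fun c => by
    rw [Set.mem_ofPred_eq, differentialFunction_algebraMap, map_zero]

lemma anchor_casimir {f : SmoothFunction E M} (hf : f ∈ P.casimirs) (α : OneForm E M) :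
    P.cotangentAlgebroid.anchor α f = 0 := by
  have h : P.sharp (differentialFunction f) = 0 := hf
  change P.bivector α (differentialFunction f) = 0
  rw [bivector_skew, bivector, h, map_zero, neg_zero]

/-- The Poisson cohomology `H^k_Λ(M)`: cohomology of the multivector fields with `σ`. -/
abbrev PCohomology (k : ℕ) : Type _ :=
  TotalCohomology P.cotangentAlgebroid P.casimirs (fun _ hf α => P.anchor_casimir hf α) k

/-- The tangent space at `x` of the symplectic leaf through `x`: the image of `#` at `x`. -/
def leafTangent (x : M) : Submodule ℝ (TangentSpace 𝓘(ℝ, E) x) where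
  carrier := {u | ∃ α : OneForm E M, P.sharp α x = u}
  zero_mem' := ⟨0, by rw [map_zero]; rfl⟩
  add_mem' := by
    rintro _ _ ⟨α, rfl⟩ ⟨β, rfl⟩
    exact ⟨α + β, by rw [map_add]; rfl⟩
  smul_mem' := by
    rintro c _ ⟨α, rfl⟩
    exact ⟨algebraMap ℝ (SmoothFunction E M) c • α, by rw [map_smul]; rfl⟩

/-- The Poisson structure is regular of rank `r`. -/
def IsRegularOfRank (r : ℕ) : Prop :=
  ∀ x : M, Module.finrank ℝ (P.leafTangent x) = r

/-- The vector fields tangent to the leaves of the symplectic foliation. -/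
def tangentialFields : Submodule (SmoothFunction E M) (SmoothVectorField E M) where
  carrier := {X | ∀ x, X x ∈ P.leafTangent x}
  zero_mem' := fun x => (P.leafTangent x).zero_mem
  add_mem' := fun hX hY x => (P.leafTangent x).add_mem (hX x) (hY x)
  smul_mem' := fun f _ hX x => (P.leafTangent x).smul_mem (f x) (hX x)

lemma tangential_casimir {f : SmoothFunction E M} (hf : f ∈ P.casimirs)
    {X : SmoothVectorField E M} (hX : X ∈ P.tangentialFields) :
    (tangentAlgebroid E M).anchor X f = 0 := by
  ext x
  obtain ⟨α, hα⟩ := hX x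
  have h := congrArg (fun g : SmoothFunction E M => g x) (P.anchor_casimir hf α)
  rw [anchor_apply, lieDerivFunction_apply, ← hα]
  exact h

/-- The 1-form `β` defines the symplectic foliation: at every point its kernel is the tangent space of
the leaf. -/
def DefinesFoliation (β : DifferentialForm E M 1) : Prop :=
  ∀ (X : SmoothVectorField E M) (x : M), β (fun _ => X) x = 0 ↔ X x ∈ P.leafTangent x

/-- A smooth distribution complementary to the symplectic foliation; smoothness says that the
projection of a smooth vector field is smooth. -/
structure TransversalDistribution where
  fiber : ∀ x : M, Submodule ℝ (TangentSpace 𝓘(ℝ, E) x)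
  isCompl_fiber : ∀ x, IsCompl (P.leafTangent x) (fiber x)
  smooth : ∀ X : SmoothVectorField E M, ∃ Y : SmoothVectorField E M,
    ∀ x, Y x ∈ fiber x ∧ X x - Y x ∈ P.leafTangent x

namespace TransversalDistribution

variable {P} (ν : P.TransversalDistribution)

/-- The vector fields with values in the transversal distribution. -/
def fields : Submodule (SmoothFunction E M) (SmoothVectorField E M) where
  carrier := {X | ∀ x, X x ∈ ν.fiber x}
  zero_mem' := fun x => (ν.fiber x).zero_mem
  add_mem' := fun hX hY x => (ν.fiber x).add_mem (hX x) (hY x)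
  smul_mem' := fun f _ hX x => (ν.fiber x).smul_mem (f x) (hX x)

lemma isCompl_fields : IsCompl P.tangentialFields ν.fields := by
  constructor
  · rw [Submodule.disjoint_def]
    intro X hT hN
    ext x
    exact (Submodule.disjoint_def.1 (ν.isCompl_fiber x).disjoint) _ (hT x) (hN x)
  · rw [codisjoint_iff, Submodule.eq_top_iff']
    intro X
    obtain ⟨Y, hY⟩ := ν.smooth X
    exact Submodule.mem_sup.2 ⟨X - Y, fun x => (hY x).2, Y, fun x => (hY x).1, sub_add_cancel X Y⟩

lemma isCompl_annihilators :
    IsCompl ν.fields.dualAnnihilator P.tangentialFields.dualAnnihilator := by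
  have h := ν.isCompl_fields
  constructor
  · rw [Submodule.disjoint_def]
    intro α hN hT
    rw [Submodule.mem_dualAnnihilator] at hN hT
    ext1 X
    obtain ⟨Y, hY, Z, hZ, rfl⟩ := Submodule.mem_sup.1 (h.sup_eq_top.symm ▸ Submodule.mem_top :
      X ∈ P.tangentialFields ⊔ ν.fields)
    rw [map_add, hT Y hY, hN Z hZ]
    simp
  · rw [codisjoint_iff, Submodule.eq_top_iff']
    intro α
    refine Submodule.mem_sup.2 ⟨α ∘ₗ P.tangentialFields.projection ν.fields h, ?_,
      α ∘ₗ ν.fields.projection P.tangentialFields h.symm, ?_, ?_⟩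
    · rw [Submodule.mem_dualAnnihilator]
      intro X hX
      rw [LinearMap.comp_apply, (Submodule.projection_apply_eq_zero_iff h).2 hX, map_zero]
    · rw [Submodule.mem_dualAnnihilator]
      intro X hX
      rw [LinearMap.comp_apply, (Submodule.projection_apply_eq_zero_iff h.symm).2 hX, map_zero]
    · ext1 X
      rw [LinearMap.add_apply, LinearMap.comp_apply, LinearMap.comp_apply, ← map_add,
        Submodule.projection_add_projection_eq_self]

/-- The tangential Poisson cohomology `H^q_{Λ,tan}(M)`: the cohomology of the tangential multivector
fields (type `(0, q)`: they vanish if an argument annihilates the leaves) with the tangential part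
`σ''` of `σ`. Tangential covectors are those that annihilate the transversal distribution,
transversal ones those that annihilate the leaves. -/
abbrev TPCohomology (q : ℕ) : Type _ :=
  LeafCohomology P.cotangentAlgebroid ν.isCompl_annihilators P.casimirs
    (fun _ hf α _ => P.anchor_casimir hf α) 0 q

/-- The cohomology `H^q(M, P^p(F))` with values in the projectable `p`-forms of the foliation:
the cohomology at `Ω_{p,q}` of the forms with `p` transversal arguments and `q` tangential ones, with
the leafwise exterior derivative `d''`, the part of type `(0, 1)` of `d`. -/
abbrev ProjectableCohomology (q p : ℕ) : Type _ :=
  LeafCohomology (tangentAlgebroid E M) ν.isCompl_fields P.casimirs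
    (fun _ hf _ hX => P.tangential_casimir hf hX) p (q + p)

/-- The subspace `σ(V_{1,0})` of the second tangential Poisson cohomology: the classes of those bivector
fields `σ(V)`, `V` with values in the transversal distribution, which are tangential. -/
def sigmaTransversal : Submodule P.casimirs (ν.TPCohomology 2) :=
  transverseClasses P.cotangentAlgebroid ν.isCompl_annihilators P.casimirs
    (fun _ hf α _ => P.anchor_casimir hf α) (fun _ hf α => P.anchor_casimir hf α) 1

end TransversalDistribution
end PoissonStructure
end Geometry
end PoissonGeom
end

open PoissonGeom

/-!
The map `#` is a homomorphism of brackets, and it restricts to an isomorphism from the 1-forms that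
vanish on the transversal distribution onto the vector fields tangent to the leaves. It therefore
carries the tangential Poisson complex to the leafwise de Rham complex. Let `u` be the transversal
field with `β(u) = 1`; as `β` is closed, the flow of `u` preserves the foliation, so inserting `u`
in the transversal argument identifies the forms of type `(1, q)` with the leafwise forms of degree
`q`, up to the sign `(-1)^q` in the differential. The two identifications give (ii).

Since `#β = 0` and `dβ = 0`, the form `β` is central for the bracket of 1-forms. Hence contraction
with `β` maps the Poisson complex to the tangential complex shifted by one, up to sign, with the
multivector fields of type `(0, q)` as its kernel. Tangential multivector fields of degree above
the rank vanish; the long exact sequence then breaks off in top degree and gives the isomorphism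
for `H³`, and one degree below it leaves the extension of `H¹(M, P¹(F))` by the cokernel of the
connecting map, whose image consists of the classes `σ(V)`.
-/

noncomputable section

namespace PoissonGeom

lemma removeNth_succ_cons {X : Type*} {k : ℕ} (x : X) (t : Fin (k + 1) → X) (j : Fin (k + 1)) :
    (j.succ).removeNth (Fin.cons x t : Fin (k + 2) → X) = Fin.cons x (j.removeNth t) := by
  funext m
  cases m using Fin.cases <;> simp [Fin.removeNth]

lemma sum_Iio_succ {G : Type*} [AddCommMonoid G] {k : ℕ} (f : Fin (k + 2) → G) (j : Fin (k + 1)) :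
    ∑ i ∈ Finset.Iio j.succ, f i = f 0 + ∑ i ∈ Finset.Iio j, f i.succ := by
  have h {m : ℕ} (j : Fin m) : Finset.Iio j = Finset.univ.filter (· < j) := by ext; simp
  simp only [h, Finset.sum_filter]
  rw [Fin.sum_univ_succ, if_pos j.succ_pos]
  simp only [Fin.succ_lt_succ_iff]

section Bigrading
variable {A L : Type*} [CommRing A] [AddCommGroup L] [Module A L] {T N : Submodule A L} {k : ℕ}

lemma alternatingMap_eq_zero_of_le {m : ℕ} (hm : ∀ q : L [⋀^Fin m]→ₗ[A] A, q = 0) (hmk : m ≤ k)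
    (q : L [⋀^Fin k]→ₗ[A] A) : q = 0 := by
  induction k, hmk using Nat.le_induction with
  | base => exact hm q
  | succ k _ ih =>
    ext v
    rw [← Fin.cons_self_tail v]
    exact DFunLike.congr_fun (ih (q.curryLeft (v 0))) (Fin.tail v)

lemma pow_mul_alternatingMap_eq_zero {ι : Type*} [Fintype ι] {l : A} {e : ι → L}
    (hl : ∀ a : L, ∃ δ : ι → A, l • a = ∑ i, δ i • e i) (hk : Fintype.card ι < k)
    (q : L [⋀^Fin k]→ₗ[A] A) (v : Fin k → L) : l ^ k * q v = 0 := by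
  classical
  choose δ hδ using hl
  have h : l ^ k * q v = q fun j => ∑ i, δ (v j) i • e i := by
    simp_rw [← hδ]
    simpa using (q.toMultilinearMap.map_smul_univ (fun _ => l) v).symm
  rw [h]
  refine (q.toMultilinearMap.map_sum _).trans (Finset.sum_eq_zero fun r _ => ?_)
  obtain ⟨i, j, hij, hr⟩ := Fintype.exists_ne_map_eq_of_card_lt r (by simpa using hk)
  rw [q.toMultilinearMap.map_smul_univ]
  exact smul_eq_zero_of_right _ (q.map_eq_zero_of_eq _ (congrArg e hr) hij)

lemma sum_apply_splitArgs (h : IsCompl T N) (Q : L [⋀^Fin k]→ₗ[A] A) (v : Fin k → L) :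
    ∑ S, Q (splitArgs h S v) = Q v := by
  have hv : (fun i => N.projection T h.symm (v i)) + (fun i => T.projection N h (v i)) = v :=
    funext fun i => Submodule.projection_add_projection_eq_self h.symm (v i)
  conv_rhs => rw [← hv]
  exact (Q.toMultilinearMap.map_add_univ _ _).symm

lemma component_eq_self (h : IsCompl T N) {p : ℕ} {Q : L [⋀^Fin k]→ₗ[A] A}
    (hQ : Q ∈ ofType T N p k) : component h p k Q = Q := by
  ext v
  rw [component_apply, ← sum_apply_splitArgs h Q v]
  refine Finset.sum_subset (Finset.subset_univ _) fun S _ hS => ?_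
  exact hQ _ S (fun _ => splitArgs_mem_right h v) (fun _ => splitArgs_mem_left h v)
    fun hcard => hS (Finset.mem_powersetCard_univ.2 hcard)

lemma component_apply_of_homogeneous (h : IsCompl T N) {p : ℕ}
    (θ : L [⋀^Fin k]→ₗ[A] A) {v : Fin k → L} {S : Finset (Fin k)} (hN : ∀ i ∈ S, v i ∈ N)
    (hT : ∀ i ∉ S, v i ∈ T) (hS : S.card = p) : component h p k θ v = θ v := by
  rw [component_apply, Finset.sum_eq_single_of_mem S (Finset.mem_powersetCard_univ.2 hS)]
  · congr 1
    funext i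
    by_cases hi : i ∈ S
    · rw [splitArgs, if_pos hi, Submodule.projection_apply_of_mem_left _ (hN i hi)]
    · rw [splitArgs, if_neg hi, Submodule.projection_apply_of_mem_left _ (hT i hi)]
  · intro R hR hRS
    obtain ⟨i, hiR, hiS⟩ : ∃ i ∈ R, i ∉ S := by
      by_contra! hc
      exact hRS (Finset.eq_of_subset_of_card_le hc
        (hS.trans (Finset.mem_powersetCard_univ.1 hR).symm).le)
    refine θ.map_coord_zero i ?_
    rw [splitArgs, if_pos hiR, Submodule.projection_apply_eq_zero_iff]
    exact hT i hiS

/-- The restriction of alternating maps to a submodule. -/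
def restrictTo (T : Submodule A L) (k : ℕ) : (L [⋀^Fin k]→ₗ[A] A) →ₗ[A] (T [⋀^Fin k]→ₗ[A] A) where
  toFun Q := Q.compLinearMap T.subtype
  map_add' _ _ := rfl
  map_smul' _ _ := rfl

lemma restrictTo_apply (Q : L [⋀^Fin k]→ₗ[A] A) (t : Fin k → T) :
    restrictTo T k Q t = Q fun i => t i := rfl

/-- The extension by zero of an alternating map on `T` along the complement `N`. -/
def extendAlong (h : IsCompl T N) (q : T [⋀^Fin k]→ₗ[A] A) : L [⋀^Fin k]→ₗ[A] A :=
  q.compLinearMap (T.projectionOnto N h)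

lemma extendAlong_apply (h : IsCompl T N) (q : T [⋀^Fin k]→ₗ[A] A) (v : Fin k → L) :
    extendAlong h q v = q fun i => T.projectionOnto N h (v i) := rfl

lemma extendAlong_mem_ofType (h : IsCompl T N) (q : T [⋀^Fin k]→ₗ[A] A) :
    extendAlong h q ∈ ofType T N 0 k := by
  intro v S hN _ hS
  obtain ⟨i, hi⟩ := Finset.card_ne_zero.1 hS
  exact q.map_coord_zero i ((Submodule.projectionOnto_apply_eq_zero_iff h).2 (hN i hi))

lemma restrictTo_extendAlong (h : IsCompl T N) (q : T [⋀^Fin k]→ₗ[A] A) :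
    restrictTo T k (extendAlong h q) = q := by
  ext t
  simp only [restrictTo_apply, extendAlong_apply, Submodule.projectionOnto_apply_left]

lemma extendAlong_restrictTo (h : IsCompl T N) {Q : L [⋀^Fin k]→ₗ[A] A}
    (hQ : Q ∈ ofType T N 0 k) : extendAlong h (restrictTo T k Q) = Q := by
  conv_rhs => rw [← component_eq_self h hQ]
  ext v
  rw [component_apply, Finset.powersetCard_zero, Finset.sum_singleton]
  rfl

lemma projectionOnto_removeNth_update (h : IsCompl T N) (t : Fin (k + 1) → T) (i j : Fin (k + 1))
    (z : L) :
    (fun m => T.projectionOnto N h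
        (j.removeNth (Function.update (fun i => (t i : L)) i z) m)) =
      j.removeNth (Function.update t i (T.projectionOnto N h z)) := by
  funext m
  have ht : t = fun i => T.projectionOnto N h (t i : L) :=
    funext fun i => (Submodule.projectionOnto_apply_left h (t i)).symm
  conv_rhs => rw [ht]
  exact congrFun (Function.comp_update (T.projectionOnto N h) (fun i => (t i : L)) i z)
    (j.succAbove m)

lemma restrictTo_component (h : IsCompl T N) (θ : L [⋀^Fin k]→ₗ[A] A) :
    restrictTo T k (component h 0 k θ) = restrictTo T k θ := by
  ext t
  exact component_apply_of_homogeneous h θ (S := ∅) (by simp) (fun i _ => (t i).2) rfl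

lemma restrictTo_eq_zero (T : Submodule A L) {p : ℕ} (hp : p ≠ 0) {Q : L [⋀^Fin k]→ₗ[A] A}
    (hQ : Q ∈ ofType T N p k) : restrictTo T k Q = 0 := by
  ext t
  exact hQ _ ∅ (by simp) (fun i _ => (t i).2) hp.symm

end Bigrading

section LineComplement
variable {A L : Type*} [CommRing A] [AddCommGroup L] [Module A L]

/-- A decomposition `L = T ⊕ N` in which `N` is free on one generator `gen`; `coord` is the
coordinate along it. -/
structure LineComplement (T N : Submodule A L) where
  isCompl : IsCompl T N
  gen : L
  gen_mem : gen ∈ N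
  coord : L →ₗ[A] A
  coord_of_mem : ∀ t ∈ T, coord t = 0
  coord_gen : coord gen = 1
  coord_smul_gen : ∀ v ∈ N, coord v • gen = v

namespace LineComplement
variable {T N : Submodule A L} (c : LineComplement T N) {k : ℕ}

lemma apply_eq_zero_of_mem_of_mem (c : LineComplement T N) (Q : L [⋀^Fin k]→ₗ[A] A) {v : Fin k → L}
    {i j : Fin k} (hij : i ≠ j) (hi : v i ∈ N) (hj : v j ∈ N) : Q v = 0 := by
  have hv : v = Function.update (Function.update v i (c.coord (v i) • c.gen)) j
      (c.coord (v j) • c.gen) := by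
    rw [c.coord_smul_gen _ hi, c.coord_smul_gen _ hj, Function.update_eq_self,
      Function.update_eq_self]
  rw [hv, Q.map_update_smul, Function.update_comm hij, Q.map_update_smul,
    Q.map_eq_zero_of_eq _ (by simp [Function.update_of_ne hij.symm]) hij, smul_zero, smul_zero]

/-- The contraction of an alternating map with the generator of the complement, restricted
to `T`. -/
def contract (k : ℕ) : (L [⋀^Fin (k + 1)]→ₗ[A] A) →ₗ[A] (T [⋀^Fin k]→ₗ[A] A) where
  toFun Q := restrictTo T k (Q.curryLeft c.gen)
  map_add' _ _ := rfl
  map_smul' _ _ := rfl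

lemma contract_apply (Q : L [⋀^Fin (k + 1)]→ₗ[A] A) (t : Fin k → T) :
    c.contract k Q t = Q (Fin.cons c.gen fun i => (t i : L)) := rfl

lemma curryLeft_gen_mem_ofType (Q : L [⋀^Fin (k + 1)]→ₗ[A] A) :
    Q.curryLeft c.gen ∈ ofType T N 0 k := by
  intro v S hN _ hS
  obtain ⟨i, hi⟩ := Finset.card_ne_zero.1 hS
  exact c.apply_eq_zero_of_mem_of_mem Q (Fin.succ_ne_zero i).symm c.gen_mem (hN i hi)

lemma apply_cons_gen (Q : L [⋀^Fin (k + 1)]→ₗ[A] A) (w : Fin k → L) :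
    Q (Fin.cons c.gen w) = c.contract k Q fun i => T.projectionOnto N c.isCompl (w i) :=
  (DFunLike.congr_fun (extendAlong_restrictTo c.isCompl (c.curryLeft_gen_mem_ofType Q)) w).symm

lemma cons_gen_mem (t : Fin k → T) :
    (∀ i ∈ ({0} : Finset (Fin (k + 1))), (Fin.cons c.gen fun i => (t i : L) : _ → L) i ∈ N) ∧
      ∀ i ∉ ({0} : Finset (Fin (k + 1))), (Fin.cons c.gen fun i => (t i : L) : _ → L) i ∈ T := by
  constructor <;> intro i
  · rw [Finset.mem_singleton]
    rintro rfl
    exact c.gen_mem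
  · cases i using Fin.cases with
    | zero => simp
    | succ j => exact fun _ => (t j).2

lemma contract_component (θ : L [⋀^Fin (k + 1)]→ₗ[A] A) :
    c.contract k (component c.isCompl 1 (k + 1) θ) = c.contract k θ := by
  ext t
  exact component_apply_of_homogeneous c.isCompl θ (c.cons_gen_mem t).1 (c.cons_gen_mem t).2
    (Finset.card_singleton _)

lemma mem_ofType_zero_iff {Q : L [⋀^Fin (k + 1)]→ₗ[A] A} :
    Q ∈ ofType T N 0 (k + 1) ↔ c.contract k Q = 0 := by
  constructor
  · intro hQ
    ext t
    exact hQ _ {0} (c.cons_gen_mem t).1 (c.cons_gen_mem t).2 (by simp)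
  · intro hQ v S hN _ hS
    obtain ⟨i, hi⟩ := Finset.card_ne_zero.1 hS
    have hcons : Q (Matrix.vecCons (v i) (i.removeNth v)) = 0 := by
      rw [← c.coord_smul_gen _ (hN i hi)]
      refine (Q.toMultilinearMap.cons_smul _ _ _).trans ?_
      refine (congrArg _ (c.apply_cons_gen Q (i.removeNth v))).trans ?_
      rw [hQ, AlternatingMap.zero_apply, smul_zero]
    rw [← Fin.insertNth_self_removeNth i v, Q.map_insertNth, hcons, smul_zero]

lemma mem_ofType_one_iff (c : LineComplement T N) {Q : L [⋀^Fin k]→ₗ[A] A} :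
    Q ∈ ofType T N 1 k ↔ restrictTo T k Q = 0 := by
  refine ⟨restrictTo_eq_zero T one_ne_zero, fun hQ v S hN hT hS => ?_⟩
  rcases S.eq_empty_or_nonempty with rfl | hne
  · exact DFunLike.congr_fun hQ fun i => ⟨v i, hT i (Finset.notMem_empty i)⟩
  · obtain ⟨i, hi, j, hj, hij⟩ :=
      Finset.one_lt_card.1 (lt_of_le_of_ne (Finset.card_pos.2 hne) hS.symm)
    exact c.apply_eq_zero_of_mem_of_mem Q hij (hN i hi) (hN j hj)

lemma eq_of_contract_eq {Q S : L [⋀^Fin (k + 1)]→ₗ[A] A} (hc : c.contract k Q = c.contract k S)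
    (hr : restrictTo T (k + 1) Q = restrictTo T (k + 1) S) : Q = S := by
  rw [← sub_eq_zero] at hc hr ⊢
  rw [← map_sub] at hc hr
  rw [← extendAlong_restrictTo c.isCompl (c.mem_ofType_zero_iff.2 hc), hr]
  rfl

/-- The alternating map `coord ∧ q`, whose contraction with the generator is `q`. -/
def wedgeCoord (q : T [⋀^Fin k]→ₗ[A] A) : L [⋀^Fin (k + 1)]→ₗ[A] A :=
  AlternatingMap.alternatizeUncurryFin (c.coord.smulRight (extendAlong c.isCompl q))

lemma wedgeCoord_apply (q : T [⋀^Fin k]→ₗ[A] A) (v : Fin (k + 1) → L) :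
    c.wedgeCoord q v = ∑ i : Fin (k + 1),
      (-1) ^ (i : ℕ) • (c.coord (v i) * extendAlong c.isCompl q (i.removeNth v)) := by
  rw [wedgeCoord, AlternatingMap.alternatizeUncurryFin_apply]
  rfl

lemma contract_wedgeCoord (q : T [⋀^Fin k]→ₗ[A] A) : c.contract k (c.wedgeCoord q) = q := by
  ext t
  rw [contract_apply, wedgeCoord_apply, Fin.sum_univ_succ, Finset.sum_eq_zero, add_zero]
  · rw [Fin.cons_zero, c.coord_gen, one_mul, Fin.val_zero, pow_zero, one_smul]
    exact DFunLike.congr_fun (restrictTo_extendAlong c.isCompl q) t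
  · intro i _
    rw [Fin.cons_succ, c.coord_of_mem _ (t i).2, zero_mul, smul_zero]

lemma restrictTo_wedgeCoord (q : T [⋀^Fin k]→ₗ[A] A) :
    restrictTo T (k + 1) (c.wedgeCoord q) = 0 := by
  ext t
  rw [restrictTo_apply, wedgeCoord_apply]
  exact Finset.sum_eq_zero fun i _ => by rw [c.coord_of_mem _ (t i).2, zero_mul, smul_zero]

end LineComplement
end LineComplement

section Bracket
variable {A L L' : Type*} [CommRing A] [Algebra ℝ A] [AddCommGroup L] [Module A L]
  [AddCommGroup L'] [Module A L'] {T N : Submodule A L} (B : AnchoredBracket A L) {k : ℕ}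

lemma AnchoredBracket.differential_compLinearMap (B' : AnchoredBracket A L') (e : L →ₗ[A] L')
    (ha : ∀ a, B'.anchor (e a) = B.anchor a)
    (hb : ∀ a b, e (B.bracket a b) = B'.bracket (e a) (e b)) (Q : L' [⋀^Fin k]→ₗ[A] A) :
    B.differential k (Q.compLinearMap e) = (B'.differential k Q).compLinearMap e := by
  ext v
  change B.differentialFun _ v = B'.differentialFun Q fun i => e (v i)
  rw [AnchoredBracket.differentialFun, AnchoredBracket.differentialFun]
  refine congrArg₂ (· + ·) (Finset.sum_congr rfl fun j _ => ?_)
    (Finset.sum_congr rfl fun j _ => Finset.sum_congr rfl fun i _ => ?_)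
  · rw [ha]
    rfl
  · rw [← hb]
    change _ * Q _ = _
    congr 2
    funext m
    exact congrFun (Function.comp_update e v i (B.bracket (v i) (v j))) (j.succAbove m)

/-- The bracket on `T` obtained by projecting the bracket of `L` along the complement `N`. -/
def AnchoredBracket.restrict (h : IsCompl T N) : AnchoredBracket A T where
  anchor := B.anchor ∘ₗ T.subtype
  bracket a b := T.projectionOnto N h (B.bracket a b)
  bracket_add a b c := by rw [Submodule.coe_add, B.bracket_add, map_add]
  bracket_skew a b := by rw [B.bracket_skew, map_neg]
  bracket_smul a f b := by
    rw [Submodule.coe_smul, B.bracket_smul, map_add, map_smul, map_smul,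
      Submodule.projectionOnto_apply_left]
    rfl

lemma restrictTo_differential (h : IsCompl T N) {Q : L [⋀^Fin k]→ₗ[A] A}
    (hQ : Q ∈ ofType T N 0 k) : restrictTo T (k + 1) (B.differential k Q) =
      (B.restrict h).differential k (restrictTo T k Q) := by
  ext t
  change B.differentialFun Q _ = (B.restrict h).differentialFun _ t
  refine congrArg₂ (· + ·) rfl
    (Finset.sum_congr rfl fun j _ => Finset.sum_congr rfl fun i _ => ?_)
  conv_lhs => rw [← extendAlong_restrictTo h hQ, extendAlong_apply]
  exact congrArg _ (congrArg _ (projectionOnto_removeNth_update h t i j _))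

namespace LineComplement
variable {B} (c : LineComplement T N)

lemma contract_differential_zero (Q : L [⋀^Fin 0]→ₗ[A] A) (t : Fin 0 → T) :
    c.contract 0 (B.differential 0 Q) t = B.anchor c.gen (Q fun i => t i) := by
  have hIio : Finset.Iio (0 : Fin 1) = ∅ := rfl
  rw [contract_apply, AnchoredBracket.differential_apply, AnchoredBracket.differentialFun]
  simp [hIio]

-- Cartan's formula `i_X d = L_X - d i_X` for `X = gen`, evaluated on arguments in `T`.
lemma contract_differential (Q : L [⋀^Fin (k + 1)]→ₗ[A] A) (t : Fin (k + 1) → T) :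
    c.contract (k + 1) (B.differential (k + 1) Q) t =
      B.anchor c.gen (Q fun i => t i) -
        ∑ j, Q (Function.update (fun i => (t i : L)) j (B.bracket c.gen (t j))) -
        (B.restrict c.isCompl).differential k (c.contract k Q) t := by
  have hbracket (j : Fin (k + 1)) (z : L) :
      (-1) ^ (j : ℕ) * Q (Fin.cons z (j.removeNth fun i => (t i : L))) =
        Q (Function.update (fun i => (t i : L)) j z) := by
    rw [← Fin.insertNth_removeNth, Q.map_insertNth]
    simp [Matrix.vecCons, zsmul_eq_mul]
  have hIio : Finset.Iio (0 : Fin (k + 2)) = ∅ := Finset.Iio_bot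
  have hproj (i j : Fin (k + 1)) : Q (Fin.cons c.gen (j.removeNth
      (Function.update (fun i => (t i : L)) i (B.bracket (t i) (t j))))) = c.contract k Q
        (j.removeNth (Function.update t i ((B.restrict c.isCompl).bracket (t i) (t j)))) := by
    rw [apply_cons_gen, projectionOnto_removeNth_update]
    rfl
  have hcontract (j : Fin (k + 1)) : Q (Fin.cons c.gen (j.removeNth fun i => (t i : L))) =
    c.contract k Q (j.removeNth t) := rfl
  rw [contract_apply, AnchoredBracket.differential_apply, AnchoredBracket.differential_apply,
    AnchoredBracket.differentialFun, AnchoredBracket.differentialFun,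
    Fin.sum_univ_succ (n := k + 1), Fin.sum_univ_succ (n := k + 1), hIio, Finset.sum_empty]
  simp only [sum_Iio_succ, removeNth_succ_cons, Fin.update_cons_zero, ← Fin.cons_update,
    Fin.removeNth_zero, Fin.tail_cons, Fin.cons_zero, Fin.cons_succ, Fin.val_zero, Fin.val_succ,
    pow_succ, hproj, hcontract, Finset.sum_add_distrib, mul_neg, neg_mul, mul_one, hbracket,
    Finset.sum_neg_distrib, pow_zero, one_mul, zero_add]
  simp only [AnchoredBracket.restrict, LinearMap.comp_apply, Submodule.subtype_apply]
  ring

lemma contract_differential_of_mem_ofType_one (hT : ∀ t ∈ T, B.bracket c.gen t ∈ T)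
    {Q : L [⋀^Fin (k + 1)]→ₗ[A] A} (hQ : Q ∈ ofType T N 1 (k + 1)) :
    c.contract (k + 1) (B.differential (k + 1) Q) =
      -(B.restrict c.isCompl).differential k (c.contract k Q) := by
  have hQ₀ {v : Fin (k + 1) → L} (hv : ∀ i, v i ∈ T) : Q v = 0 :=
    DFunLike.congr_fun (c.mem_ofType_one_iff.1 hQ) fun i => (⟨v i, hv i⟩ : T)
  ext t
  rw [contract_differential, hQ₀ fun i => (t i).2, map_zero, Finset.sum_eq_zero, sub_zero,
    zero_sub, AlternatingMap.neg_apply]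
  intro j _
  refine hQ₀ fun i => ?_
  obtain rfl | hij := eq_or_ne i j
  · rw [Function.update_self]
    exact hT _ (t i).2
  · rw [Function.update_of_ne hij]
    exact (t i).2

variable (B) in
/-- The generator of the complement is central: it acts trivially on functions and on `T`. -/
structure IsCentral : Prop where
  anchor_gen : B.anchor c.gen = 0
  bracket_gen : ∀ t ∈ T, B.bracket c.gen t = 0

variable {c}

lemma IsCentral.contract_differential (hc : c.IsCentral B) (Q : L [⋀^Fin (k + 1)]→ₗ[A] A) :
    c.contract (k + 1) (B.differential (k + 1) Q) =
      -(B.restrict c.isCompl).differential k (c.contract k Q) := by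
  ext t
  rw [c.contract_differential, hc.anchor_gen, Derivation.zero_apply, Finset.sum_eq_zero, sub_zero,
    zero_sub, AlternatingMap.neg_apply]
  intro j _
  exact Q.map_coord_zero j (by rw [Function.update_self, hc.bracket_gen _ (t j).2])

lemma IsCentral.contract_differential_zero (hc : c.IsCentral B) (Q : L [⋀^Fin 0]→ₗ[A] A) :
    c.contract 0 (B.differential 0 Q) = 0 := by
  ext t
  rw [c.contract_differential_zero, hc.anchor_gen]
  rfl

lemma IsCentral.differential_mem_ofType_zero (hc : c.IsCentral B) {Q : L [⋀^Fin k]→ₗ[A] A}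
    (hQ : Q ∈ ofType T N 0 k) : B.differential k Q ∈ ofType T N 0 (k + 1) := by
  rw [c.mem_ofType_zero_iff]
  cases k with
  | zero => exact hc.contract_differential_zero Q
  | succ k => rw [hc.contract_differential, c.mem_ofType_zero_iff.1 hQ, map_zero, neg_zero]

end LineComplement
end Bracket

namespace Cohomology
variable {R : Type*} [CommRing R] {C D F : ℕ → Type*}
  [∀ k, AddCommGroup (C k)] [∀ k, Module R (C k)] [∀ k, AddCommGroup (D k)] [∀ k, Module R (D k)]
  [∀ k, AddCommGroup (F k)] [∀ k, Module R (F k)] {d : ∀ k, C k →ₗ[R] C (k + 1)}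
  {d' : ∀ k, D k →ₗ[R] D (k + 1)} {d'' : ∀ k, F k →ₗ[R] F (k + 1)} {k m n : ℕ}

lemma mk_surjective : Function.Surjective (mk d k) := Submodule.mkQ_surjective _

lemma mk_eq_zero {x : LinearMap.ker (d k)} : mk d k x = 0 ↔ (x : C k) ∈ coboundaries d k :=
  (Submodule.Quotient.mk_eq_zero _).trans Iff.rfl

lemma mk_eq_mk {x y : LinearMap.ker (d k)} :
    mk d k x = mk d k y ↔ (x - y : C k) ∈ coboundaries d k := by
  rw [← sub_eq_zero, ← map_sub, mk_eq_zero, Submodule.coe_sub]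

lemma mk_mem_classesIn {W : Submodule R (C k)} {x : LinearMap.ker (d k)} :
    mk d k x ∈ classesIn d k W ↔ ∃ w ∈ W, d k w = 0 ∧ (x - w : C k) ∈ coboundaries d k := by
  constructor
  · rintro ⟨w, hw, hwx⟩
    exact ⟨w, hw, w.2, mk_eq_mk.1 hwx.symm⟩
  · rintro ⟨w, hw, hdw, hwx⟩
    exact ⟨⟨w, hdw⟩, hw, (mk_eq_mk.2 hwx).symm⟩

/-- The map induced on cohomology by a map of cochains in a single degree which preserves cocycles
and coboundaries. -/
def map (f : C k →ₗ[R] D m) (hz : ∀ x, d k x = 0 → d' m (f x) = 0)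
    (hb : ∀ x ∈ coboundaries d k, f x ∈ coboundaries d' m) : Cohomology d k →ₗ[R] Cohomology d' m :=
  Submodule.mapQ _ _ (f.restrict (p := LinearMap.ker (d k)) (q := LinearMap.ker (d' m)) hz)
    fun x hx => hb x hx

section map
variable {f : C k →ₗ[R] D m} {hz : ∀ x, d k x = 0 → d' m (f x) = 0}
  {hb : ∀ x ∈ coboundaries d k, f x ∈ coboundaries d' m}

lemma map_mk (x : LinearMap.ker (d k)) :
    map f hz hb (mk d k x) = mk d' m ⟨f x, hz x x.2⟩ := rfl

lemma map_surjective (hf : ∀ y, d' m y = 0 → ∃ x, d k x = 0 ∧ f x = y) :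
    Function.Surjective (map f hz hb) := by
  intro q
  obtain ⟨⟨y, hy⟩, rfl⟩ := mk_surjective q
  obtain ⟨x, hx, rfl⟩ := hf y hy
  exact ⟨mk d k ⟨x, hx⟩, rfl⟩

lemma ker_map {W : Submodule R (C k)} (hW : ∀ x, d k x = 0 → (f x ∈ coboundaries d' m ↔
      ∃ w ∈ W, d k w = 0 ∧ x - w ∈ coboundaries d k)) :
    LinearMap.ker (map f hz hb) = classesIn d k W := by
  ext q
  obtain ⟨x, rfl⟩ := mk_surjective q
  rw [LinearMap.mem_ker, map_mk, mk_eq_zero, mk_mem_classesIn, hW x x.2]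

lemma range_map_eq_ker_map {g : D m →ₗ[R] F n} {hz' : ∀ y, d' m y = 0 → d'' n (g y) = 0}
    {hb' : ∀ y ∈ coboundaries d' m, g y ∈ coboundaries d'' n} (hgf : ∀ x, g (f x) = 0)
    (hg : ∀ y, d' m y = 0 → g y ∈ coboundaries d'' n →
      ∃ x, d k x = 0 ∧ f x - y ∈ coboundaries d' m) :
    LinearMap.range (map f hz hb) = LinearMap.ker (map g hz' hb') := by
  ext q
  obtain ⟨y, rfl⟩ := mk_surjective q
  rw [LinearMap.mem_ker, map_mk, mk_eq_zero]
  constructor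
  · rintro ⟨p, hp⟩
    obtain ⟨x, rfl⟩ := mk_surjective p
    have h : g (f x - y) ∈ coboundaries d'' n := hb' _ (mk_eq_mk.1 hp)
    rwa [map_sub, hgf, zero_sub, neg_mem_iff] at h
  · intro hy
    obtain ⟨x, hx, hxy⟩ := hg y y.2 hy
    exact ⟨mk d k ⟨x, hx⟩, mk_eq_mk.2 hxy⟩

end map

/-- The equivalence of cohomology groups induced by an equivalence of cochains in a single degree
which preserves cocycles and coboundaries. -/
def equiv (e : C k ≃ₗ[R] D m) (hz : ∀ x, d k x = 0 ↔ d' m (e x) = 0)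
    (hb : ∀ x, x ∈ coboundaries d k ↔ e x ∈ coboundaries d' m) :
    Cohomology d k ≃ₗ[R] Cohomology d' m :=
  LinearEquiv.ofBijective
    (map (e : C k →ₗ[R] D m) (fun x => (hz x).1) fun x => (hb x).1)
    ⟨(injective_iff_map_eq_zero _).2 fun q hq => by
        obtain ⟨x, rfl⟩ := mk_surjective q
        exact mk_eq_zero.2 ((hb x).2 (mk_eq_zero.1 hq)),
      map_surjective fun y hy => ⟨e.symm y, by rw [hz, e.apply_symm_apply, hy],
        e.apply_symm_apply y⟩⟩

/-- Isomorphic complexes have isomorphic cohomology. -/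
def equivOfComm (e : ∀ k, C k ≃ₗ[R] D k) (he : ∀ k x, d' k (e k x) = e (k + 1) (d k x)) (k : ℕ) :
    Cohomology d k ≃ₗ[R] Cohomology d' k :=
  equiv (e k) (fun x => by rw [he, LinearEquiv.map_eq_zero_iff]) fun x => by
    cases k with
    | zero => exact (LinearEquiv.map_eq_zero_iff (e 0)).symm
    | succ k =>
      simp only [coboundaries, LinearMap.mem_range, (e k).surjective.exists, he,
        (e (k + 1)).injective.eq_iff]

/-- An isomorphism of complexes of degree `-1` which anticommutes with the differentials, for a
complex with no cochains of degree `0`, induces isomorphisms of the cohomology groups. -/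
def equivOfAnticomm [Subsingleton (C 0)] (e : ∀ k, C (k + 1) ≃ₗ[R] D k)
    (he : ∀ k x, d' k (e k x) = -e (k + 1) (d (k + 1) x)) (k : ℕ) :
    Cohomology d (k + 1) ≃ₗ[R] Cohomology d' k :=
  equiv (e k) (fun x => by rw [he, neg_eq_zero, LinearEquiv.map_eq_zero_iff]) fun x => by
    cases k with
    | zero =>
      simp only [coboundaries, LinearMap.range_eq_bot.2 (Subsingleton.elim (d 0) 0),
        Submodule.mem_bot, LinearEquiv.map_eq_zero_iff]
    | succ k =>
      simp only [coboundaries, LinearMap.mem_range, (e k).surjective.exists, he, ← map_neg,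
        (e (k + 1)).injective.eq_iff]
      exact ⟨fun ⟨y, hy⟩ => ⟨-y, by simpa using hy⟩, fun ⟨y, hy⟩ => ⟨-y, by simpa using hy⟩⟩

end Cohomology

lemma exists_equiv_quotient_prod {R U V W : Type*} [CommRing R] [Algebra ℝ R]
    [AddCommGroup U] [AddCommGroup V] [AddCommGroup W] [Module R U] [Module R V] [Module R W]
    [Module ℝ U] [Module ℝ V] [Module ℝ W] [IsScalarTower ℝ R U] [IsScalarTower ℝ R V]
    [IsScalarTower ℝ R W] {f : U →ₗ[R] V} {g : V →ₗ[R] W} {K : Submodule R U}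
    (hK : LinearMap.ker f = K) (hfg : LinearMap.range f = LinearMap.ker g)
    (hg : Function.Surjective g) : Nonempty (V ≃ₗ[ℝ] (U ⧸ K) × W) := by
  subst hK
  let f' : (U ⧸ LinearMap.ker f) →ₗ[R] V := (LinearMap.ker f).liftQ f le_rfl
  have hf' : Function.Injective f' :=
    LinearMap.ker_eq_bot.1 (Submodule.ker_liftQ_eq_bot _ _ _ le_rfl)
  have hexact : Function.Exact f' g :=
    LinearMap.exact_iff.2 (hfg.symm.trans (Submodule.range_liftQ _ _ _).symm)
  obtain ⟨s, hs⟩ := (g.restrictScalars ℝ).exists_rightInverse_of_surjective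
    (LinearMap.range_eq_top.2 hg)
  exact ⟨(Function.Exact.splitSurjectiveEquiv (f := f'.restrictScalars ℝ)
    (g := g.restrictScalars ℝ) hexact hf' ⟨s, hs⟩).1⟩

section LeafCohomology
variable {A L : Type*} [CommRing A] [Algebra ℝ A] [AddCommGroup L] [Module A L]
  {T N : Submodule A L}

/-- Isomorphic anchored brackets have isomorphic cohomology. -/
def totalCohomologyEquiv {L' : Type*} [AddCommGroup L'] [Module A L'] (B : AnchoredBracket A L)
    (B' : AnchoredBracket A L') (R : Subalgebra ℝ A) (hR : ∀ f ∈ R, ∀ a, B.anchor a f = 0)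
    (hR' : ∀ f ∈ R, ∀ a, B'.anchor a f = 0) (e : L ≃ₗ[A] L')
    (ha : ∀ a, B'.anchor (e a) = B.anchor a)
    (hb : ∀ a b, e (B.bracket a b) = B'.bracket (e a) (e b)) (k : ℕ) :
    TotalCohomology B' R hR' k ≃ₗ[R] TotalCohomology B R hR k :=
  Cohomology.equivOfComm
    (fun k =>
      { toFun := fun Q : L' [⋀^Fin k]→ₗ[A] A => Q.compLinearMap (e : L →ₗ[A] L')
        map_add' := fun _ _ => rfl
        map_smul' := fun _ _ => rfl
        invFun := fun Q => Q.compLinearMap (e.symm : L' →ₗ[A] L)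
        left_inv := fun Q => by ext v; simp
        right_inv := fun Q => by ext v; simp })
    (fun _ Q => B.differential_compLinearMap B' e ha hb Q) k

/-- Cochains of type `(0, k)` are the alternating `k`-linear maps on `T`. -/
def ofTypeZeroEquiv (h : IsCompl T N) (R : Subalgebra ℝ A) (k : ℕ) :
    ofType T N 0 k ≃ₗ[R] (T [⋀^Fin k]→ₗ[A] A) where
  toFun Q := restrictTo T k Q
  map_add' _ _ := rfl
  map_smul' _ _ := rfl
  invFun q := ⟨extendAlong h q, extendAlong_mem_ofType h q⟩
  left_inv Q := Subtype.ext (extendAlong_restrictTo h Q.2)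
  right_inv q := restrictTo_extendAlong h q

/-- Cochains of type `(1, k)` are the alternating `k`-linear maps on `T`. -/
def LineComplement.ofTypeOneEquiv (c : LineComplement T N) (R : Subalgebra ℝ A) (k : ℕ) :
    ofType T N 1 (k + 1) ≃ₗ[R] (T [⋀^Fin k]→ₗ[A] A) where
  toFun Q := c.contract k Q
  map_add' _ _ := rfl
  map_smul' _ _ := rfl
  invFun q := ⟨c.wedgeCoord q, c.mem_ofType_one_iff.2 (c.restrictTo_wedgeCoord q)⟩
  left_inv Q := Subtype.ext (c.eq_of_contract_eq (c.contract_wedgeCoord _)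
    ((c.restrictTo_wedgeCoord _).trans (c.mem_ofType_one_iff.1 Q.2).symm))
  right_inv q := c.contract_wedgeCoord q

section
variable (B : AnchoredBracket A L) (R : Subalgebra ℝ A)
  (hR : ∀ f ∈ R, ∀ a ∈ T, B.anchor a f = 0)

/-- The cohomology of `T` with the bracket projected along the complement. -/
abbrev RestrictedCohomology (h : IsCompl T N) (k : ℕ) : Type _ :=
  TotalCohomology (B.restrict h) R (fun f hf a => hR f hf a a.2) k

/-- The leafwise cohomology of type `(0, •)` is the cohomology of the projected bracket. -/
def leafCohomologyZeroEquiv (h : IsCompl T N) (k : ℕ) :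
    LeafCohomology B h R hR 0 k ≃ₗ[R] RestrictedCohomology B R hR h k :=
  Cohomology.equivOfComm (C := fun j => ofType T N 0 j) (ofTypeZeroEquiv h R)
    (fun _ Q => ((restrictTo_component h _).trans (restrictTo_differential B h Q.2)).symm) k

/-- The leafwise cohomology of type `(1, •)` is the cohomology of the projected bracket, if
bracketing with the generator of the complement preserves `T`. -/
def leafCohomologyOneEquiv (c : LineComplement T N) (hT : ∀ t ∈ T, B.bracket c.gen t ∈ T) (k : ℕ) :
    LeafCohomology B c.isCompl R hR 1 (k + 1) ≃ₗ[R] RestrictedCohomology B R hR c.isCompl k :=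
  have : Subsingleton (ofType T N 1 0) := ⟨fun Q S => Subtype.ext (by
    ext v
    rw [Q.2 v ∅ (by simp) (fun i => i.elim0) zero_ne_one, S.2 v ∅ (by simp) (fun i => i.elim0)
      zero_ne_one])⟩
  Cohomology.equivOfAnticomm (C := fun j => ofType T N 1 j) (c.ofTypeOneEquiv R)
    (fun k Q => by
      change (B.restrict c.isCompl).differential k (c.contract k Q) =
        -c.contract (k + 1) (component c.isCompl 1 (k + 2) (B.differential (k + 1) Q))
      rw [c.contract_component, c.contract_differential_of_mem_ofType_one hT Q.2, neg_neg]) k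

end

namespace LineComplement.IsCentral
variable {c : LineComplement T N} {B : AnchoredBracket A L}
  (R : Subalgebra ℝ A) (hR : ∀ f ∈ R, ∀ a, B.anchor a f = 0) {k : ℕ}

lemma coe_leafDifferential_zero (hc : c.IsCentral B)
    (hR : ∀ f ∈ R, ∀ a ∈ T, B.anchor a f = 0) (Q : ofType T N 0 k) :
    (leafDifferential B c.isCompl R hR 0 k Q : L [⋀^Fin (k + 1)]→ₗ[A] A) = B.differential k Q :=
  component_eq_self c.isCompl (hc.differential_mem_ofType_zero Q.2)

/-- The map of cohomology induced by the inclusion of the cochains of type `(0, •)`, which form a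
subcomplex if the generator of the complement is central. -/
def leafToTotal (hc : c.IsCentral B) (k : ℕ) :
    LeafCohomology B c.isCompl R (fun f hf a _ => hR f hf a) 0 k →ₗ[R] TotalCohomology B R hR k :=
  Cohomology.map (C := fun j => ofType T N 0 j) (D := fun j => L [⋀^Fin j]→ₗ[A] A)
    { toFun := Subtype.val, map_add' := fun _ _ => rfl, map_smul' := fun _ _ => rfl }
    (fun Q hQ => (hc.coe_leafDifferential_zero R _ Q).symm.trans (congrArg Subtype.val hQ))
    (by
      cases k with
      | zero =>
        rintro _ rfl
        exact Submodule.zero_mem _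
      | succ k =>
        rintro _ ⟨Q, rfl⟩
        exact ⟨Q, (hc.coe_leafDifferential_zero R (fun f hf a _ => hR f hf a) Q).symm⟩)

/-- The map of cohomology induced by the contraction with a central generator. -/
def totalToRestricted (hc : c.IsCentral B) (k : ℕ) : TotalCohomology B R hR (k + 1) →ₗ[R]
    RestrictedCohomology B R (fun f hf a _ => hR f hf a) c.isCompl k :=
  Cohomology.map (C := fun j => L [⋀^Fin j]→ₗ[A] A) (D := fun j => T [⋀^Fin j]→ₗ[A] A)
    { toFun := c.contract k, map_add' := fun _ _ => rfl, map_smul' := fun _ _ => rfl }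
    (fun Q hQ => by
      change (B.restrict c.isCompl).differential k (c.contract k Q) = 0
      rw [← neg_eq_zero, ← hc.contract_differential, show B.differential (k + 1) Q = 0 from hQ,
        map_zero])
    (by
      rintro _ ⟨V, rfl⟩
      cases k with
      | zero => exact hc.contract_differential_zero V
      | succ k =>
        refine ⟨c.contract k (-V), ?_⟩
        change (B.restrict c.isCompl).differential k _ = c.contract (k + 1) (B.differential _ V)
        rw [hc.contract_differential, map_neg, map_neg])

lemma differential_eq_zero (hc : c.IsCentral B)
    (hv : ∀ q : T [⋀^Fin (k + 2)]→ₗ[A] A, q = 0)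
    {Q : L [⋀^Fin (k + 1)]→ₗ[A] A}
    (hQ : (B.restrict c.isCompl).differential k (c.contract k Q) = 0) :
    B.differential (k + 1) Q = 0 :=
  c.eq_of_contract_eq (by rw [hc.contract_differential, hQ, neg_zero, map_zero])
    ((hv _).trans (hv _).symm)

lemma ker_leafToTotal (hc : c.IsCentral B)
    (hv : ∀ q : T [⋀^Fin (k + 2)]→ₗ[A] A, q = 0) :
    LinearMap.ker (hc.leafToTotal R hR (k + 1)) =
      transverseClasses B c.isCompl R (fun f hf a _ => hR f hf a) hR k := by
  refine Cohomology.ker_map (C := fun j => ofType T N 0 j) (D := fun j => L [⋀^Fin j]→ₗ[A] A)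
    fun Q _ => ⟨?_, ?_⟩
  · rintro ⟨V, hV : B.differential k V = Q⟩
    let V₀ : ofType T N 0 k :=
      ⟨extendAlong c.isCompl (restrictTo T k V), extendAlong_mem_ofType c.isCompl _⟩
    have hV₀ : (Q - leafDifferential B c.isCompl R (fun f hf a _ => hR f hf a) 0 k V₀ :
        L [⋀^Fin (k + 1)]→ₗ[A] A) = B.differential k (V - V₀) := by
      rw [map_sub, hV, hc.coe_leafDifferential_zero]
    refine ⟨Q - leafDifferential B c.isCompl R _ 0 k V₀, ⟨V - V₀, ?_, hV₀.symm⟩, ?_, V₀,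
      (sub_sub_cancel _ _).symm⟩
    · rw [c.mem_ofType_one_iff, map_sub, restrictTo_extendAlong, sub_self]
    · exact (ofTypeZeroEquiv c.isCompl R (k + 2)).injective ((hv _).trans (hv _).symm)
  · rintro ⟨W, ⟨V, -, hV⟩, -, S, hS⟩
    refine ⟨V + S, ?_⟩
    change B.differential k (V + S) = Q
    rw [map_add, hV, ← hc.coe_leafDifferential_zero R fun f hf a _ => hR f hf a, hS]
    exact add_sub_cancel _ _

lemma exists_sub_mem_coboundaries (hc : c.IsCentral B) {Q : L [⋀^Fin (k + 1)]→ₗ[A] A}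
    (hQ : c.contract k Q ∈ coboundaries (C := fun j => T [⋀^Fin j]→ₗ[A] A)
      (totalDifferential (B.restrict c.isCompl) R fun f hf a => hR f hf a) k) :
    ∃ S ∈ ofType T N 0 (k + 1), S - Q ∈ coboundaries (C := fun j => L [⋀^Fin j]→ₗ[A] A)
      (totalDifferential B R hR) (k + 1) := by
  cases k with
  | zero => exact ⟨Q, c.mem_ofType_zero_iff.2 hQ, by rw [sub_self]; exact Submodule.zero_mem _⟩
  | succ k =>
    obtain ⟨r, hr⟩ := hQ
    change (B.restrict c.isCompl).differential k r = _ at hr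
    refine ⟨Q + B.differential (k + 1) (c.wedgeCoord r), c.mem_ofType_zero_iff.2 ?_,
      c.wedgeCoord r, (add_sub_cancel_left _ _).symm⟩
    rw [map_add, hc.contract_differential, c.contract_wedgeCoord, hr, add_neg_cancel]

lemma range_leafToTotal (hc : c.IsCentral B)
    (hv : ∀ q : T [⋀^Fin (k + 2)]→ₗ[A] A, q = 0) :
    LinearMap.range (hc.leafToTotal R hR (k + 1)) =
      LinearMap.ker (hc.totalToRestricted R hR k) := by
  refine Cohomology.range_map_eq_ker_map (C := fun j => ofType T N 0 j)
    (D := fun j => L [⋀^Fin j]→ₗ[A] A) (F := fun j => T [⋀^Fin j]→ₗ[A] A)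
    (fun S => c.mem_ofType_zero_iff.1 S.2) fun Q _ hQ => ?_
  obtain ⟨S, hS, hSQ⟩ := hc.exists_sub_mem_coboundaries R hR hQ
  refine ⟨⟨S, hS⟩, Subtype.ext ?_, hSQ⟩
  rw [hc.coe_leafDifferential_zero]
  exact hc.differential_eq_zero hv (by rw [c.mem_ofType_zero_iff.1 hS, map_zero])

lemma totalToRestricted_surjective (hc : c.IsCentral B)
    (hv : ∀ q : T [⋀^Fin (k + 2)]→ₗ[A] A, q = 0) :
    Function.Surjective (hc.totalToRestricted R hR k) :=
  Cohomology.map_surjective (C := fun j => L [⋀^Fin j]→ₗ[A] A)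
    (D := fun j => T [⋀^Fin j]→ₗ[A] A) fun r hr =>
      ⟨c.wedgeCoord r, hc.differential_eq_zero hv (by rw [c.contract_wedgeCoord]; exact hr),
        c.contract_wedgeCoord r⟩

lemma totalToRestricted_bijective (hc : c.IsCentral B)
    (hv : ∀ q : T [⋀^Fin (k + 1)]→ₗ[A] A, q = 0) :
    Function.Bijective (hc.totalToRestricted R hR k) := by
  have hv' := alternatingMap_eq_zero_of_le hv (Nat.le_succ (k + 1))
  refine ⟨LinearMap.ker_eq_bot.1 ?_, hc.totalToRestricted_surjective R hR hv'⟩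
  rw [← hc.range_leafToTotal R hR hv', LinearMap.range_eq_bot]
  ext q
  obtain ⟨Q, rfl⟩ := Cohomology.mk_surjective q
  rw [show Q = 0 from Subtype.ext ((ofTypeZeroEquiv c.isCompl R (k + 1)).injective
    ((hv _).trans (hv _).symm)), map_zero, map_zero, map_zero]

end LineComplement.IsCentral

end LeafCohomology

section SmoothSections
variable {E : Type*} [NormedAddCommGroup E] [NormedSpace ℝ E]
  {M : Type*} [TopologicalSpace M] [ChartedSpace E M]

lemma sum_function_apply {ι : Type*} (s : Finset ι) (f : ι → SmoothFunction E M) (x : M) :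
    (∑ i ∈ s, f i) x = ∑ i ∈ s, f i x :=
  map_sum (ContMDiffMap.evalRingHom x : SmoothFunction E M →+* ℝ) f s

variable [IsManifold 𝓘(ℝ, E) ∞ M]

lemma contMDiffVectorBundle_tangent :
    ContMDiffVectorBundle ∞ E (TangentSpace 𝓘(ℝ, E) : M → Type _) 𝓘(ℝ, E) := by
  have : IsManifold 𝓘(ℝ, E) (∞ + 1) M := by simpa using ‹IsManifold 𝓘(ℝ, E) ∞ M›
  exact TangentBundle.contMDiffVectorBundle

lemma sum_vectorField_apply {ι : Type*} (s : Finset ι) (X : ι → SmoothVectorField E M) (x : M) :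
    (∑ i ∈ s, X i) x = ∑ i ∈ s, X i x := by
  rw [← ContMDiffSection.coeAddHom_apply, map_sum, Finset.sum_apply]
  rfl

variable [FiniteDimensional ℝ E]

lemma exists_smoothFunction_eq_one_tsupport_subset [T2Space M] {x : M} {s : Set M}
    (hs : s ∈ nhds x) : ∃ f : SmoothFunction E M, f x = 1 ∧ tsupport f ⊆ s := by
  obtain ⟨f, hf, -⟩ := (SmoothBumpFunction.nhds_basis_support (I := 𝓘(ℝ, E)) hs).mem_iff.1 hs
  exact ⟨⟨f, f.contMDiff⟩, f.eq_one, hf⟩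

/-- The product of a smooth function and a vector field that is smooth near the support of the
function, as a vector field on the whole manifold. -/
def cutoffField (f : SmoothFunction E M) {u : Set M} (hu : IsOpen u) (hf : tsupport f ⊆ u)
    {X : ∀ x : M, TangentSpace 𝓘(ℝ, E) x}
    (hX : ContMDiffOn 𝓘(ℝ, E) (𝓘(ℝ, E).prod 𝓘(ℝ, E)) ∞
      (fun x => (Bundle.TotalSpace.mk' E x (X x) : TangentBundle 𝓘(ℝ, E) M)) u) :
    SmoothVectorField E M :=
  have := contMDiffVectorBundle_tangent (E := E) (M := M)
  ⟨(f : M → ℝ) • X, ContMDiffOn.smul_section_of_tsupport f.contMDiff.contMDiffOn hu hf hX⟩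

lemma exists_vectorField_apply [T2Space M] (x : M) (u : TangentSpace 𝓘(ℝ, E) x) :
    ∃ X : SmoothVectorField E M, X x = u := by
  have := contMDiffVectorBundle_tangent (E := E) (M := M)
  obtain ⟨s, hs, h⟩ := FiberBundle.exists_contMDiffOn_extend (k := ∞) 𝓘(ℝ, E) E u
  obtain ⟨f, hf₁, hf⟩ :=
    exists_smoothFunction_eq_one_tsupport_subset (E := E) (interior_mem_nhds.2 hs)
  refine ⟨cutoffField f isOpen_interior hf (h.mono interior_subset), ?_⟩
  change f x • FiberBundle.extend E u x = u
  rw [hf₁, one_smul, FiberBundle.extend_apply_self]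

section Frame
variable (f : SmoothFunction E M) {x : M}
  (hf : tsupport f ⊆ (trivializationAt E (TangentSpace 𝓘(ℝ, E) : M → Type _) x).baseSet)

/-- The local frame of the tangent bundle around `x`, multiplied by a smooth function supported in
its domain. -/
def cutoffFrame (i : Fin (Module.finrank ℝ E)) : SmoothVectorField E M :=
  have := contMDiffVectorBundle_tangent (E := E) (M := M)
  cutoffField f (trivializationAt E (TangentSpace 𝓘(ℝ, E) : M → Type _) x).open_baseSet hf
    (Bundle.Trivialization.contMDiffOn_localFrame_baseSet ∞ _ (Module.finBasis ℝ E) i)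

/-- The 1-forms dual to the local frame of the tangent bundle around `x`, multiplied by a smooth
function supported in the domain of the frame. -/
def cutoffCoframe (i : Fin (Module.finrank ℝ E)) : OneForm E M :=
  have := contMDiffVectorBundle_tangent (E := E) (M := M)
  have : ContMDiffVectorBundle 1 E (TangentSpace 𝓘(ℝ, E) : M → Type _) 𝓘(ℝ, E) :=
    ContMDiffVectorBundle.of_le (n := ∞) (by norm_cast)
  let coeff := (trivializationAt E (TangentSpace 𝓘(ℝ, E) : M → Type _) x).localFrameCoeff
    𝓘(ℝ, E) (Module.finBasis ℝ E) i
  { toFun := fun X => ⟨fun y => f y • coeff y (X y), contMDiff_of_tsupport fun _ hy =>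
      f.contMDiff.contMDiffAt.smul (contMDiffAt_localFrameCoeff (Module.finBasis ℝ E)
        (hf (tsupport_smul_subset_left _ _ hy)) X.contMDiff.contMDiffAt i)⟩
    map_add' := fun X Y => by
      ext y
      exact (congrArg (f y • ·) (map_add (coeff y) (X y) (Y y))).trans (smul_add _ _ _)
    map_smul' := fun h X => by
      ext y
      exact (congrArg (f y • ·) (map_smul (coeff y) (h y) (X y))).trans (smul_comm _ _ _) }

lemma cutoffCoframe_apply_eq_zero (i : Fin (Module.finrank ℝ E)) {X : SmoothVectorField E M}
    {y : M} (hX : X y = 0) : cutoffCoframe f hf i X y = 0 := by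
  change f y • Bundle.Trivialization.localFrameCoeff 𝓘(ℝ, E) _ _ i y (X y) = 0
  rw [hX, map_zero, smul_zero]

lemma sum_cutoffCoframe_smul_cutoffFrame (X : SmoothVectorField E M) :
    ∑ i, cutoffCoframe f hf i X • cutoffFrame f hf i = (f * f) • X := by
  have := contMDiffVectorBundle_tangent (E := E) (M := M)
  have : ContMDiffVectorBundle 1 E (TangentSpace 𝓘(ℝ, E) : M → Type _) 𝓘(ℝ, E) :=
    ContMDiffVectorBundle.of_le (n := ∞) (by norm_cast)
  set t := trivializationAt E (TangentSpace 𝓘(ℝ, E) : M → Type _) x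
  let b := Module.finBasis ℝ E
  ext y
  calc (∑ i, cutoffCoframe f hf i X • cutoffFrame f hf i) y
      = ∑ i, (f y • t.localFrameCoeff 𝓘(ℝ, E) b i y (X y)) • (f y • t.localFrame b i y) := by
        rw [sum_vectorField_apply]
        rfl
    _ = (f y * f y) • ∑ i, t.localFrameCoeff 𝓘(ℝ, E) b i y (X y) • t.localFrame b i y := by
        rw [Finset.smul_sum]
        exact Finset.sum_congr rfl fun i _ => by rw [smul_assoc, smul_comm _ (f y), smul_smul]
    _ = ((f * f) • X) y := by
        by_cases hy : y ∈ t.baseSet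
        · rw [← t.eq_sum_localFrameCoeff_smul (I := 𝓘(ℝ, E)) (b := b) (s := fun z => X z) hy]
          rfl
        · have hfy : f y = 0 := image_eq_zero_of_notMem_tsupport fun h => hy (hf h)
          change _ = (f y * f y) • X y
          rw [hfy, mul_zero, zero_smul, zero_smul]

end Frame

lemma exists_smul_eq_sum_smul [T2Space M] (x : M) :
    ∃ (e : Fin (Module.finrank ℝ E) → SmoothVectorField E M)
      (δ : Fin (Module.finrank ℝ E) → OneForm E M) (φ : SmoothFunction E M), φ x = 1 ∧
        (∀ X : SmoothVectorField E M, φ • X = ∑ i, δ i X • e i) ∧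
          ∀ X : SmoothVectorField E M, X x = 0 → ∀ i, δ i X x = 0 := by
  obtain ⟨f, hf₁, hf⟩ := exists_smoothFunction_eq_one_tsupport_subset (E := E)
    ((trivializationAt E (TangentSpace 𝓘(ℝ, E) : M → Type _) x).open_baseSet.mem_nhds
      (FiberBundle.mem_baseSet_trivializationAt' x))
  refine ⟨cutoffFrame f hf, cutoffCoframe f hf, f * f, ?_,
    fun X => (sum_cutoffCoframe_smul_cutoffFrame f hf X).symm,
    fun X hX i => cutoffCoframe_apply_eq_zero f hf i hX⟩
  change f x * f x = 1
  rw [hf₁, one_mul]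

lemma oneForm_apply_eq_zero [T2Space M] (α : OneForm E M) {X : SmoothVectorField E M} {x : M}
    (h : X x = 0) : α X x = 0 := by
  obtain ⟨e, δ, φ, hφ, hX, hδ⟩ := exists_smul_eq_sum_smul (E := E) x
  calc α X x = α (φ • X) x := by
        rw [map_smul]
        change _ = φ x * α X x
        rw [hφ, one_mul]
    _ = ∑ i, δ i X x * α (e i) x := by
        simp only [hX, map_sum, map_smul, sum_function_apply]
        rfl
    _ = 0 := Finset.sum_eq_zero fun i _ => by rw [hδ X h, zero_mul]

lemma oneForm_apply_congr [T2Space M] (α : OneForm E M) {X Y : SmoothVectorField E M} {x : M}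
    (h : X x = Y x) : α X x = α Y x := by
  have h₁ : α (X - Y) x = 0 := oneForm_apply_eq_zero α (sub_eq_zero.2 h)
  rw [map_sub] at h₁
  exact sub_eq_zero.1 h₁

lemma linearMap_apply_eq_zero_of_oneForm [T2Space M]
    (D : OneForm E M →ₗ[SmoothFunction E M] SmoothFunction E M) {α : OneForm E M} {x : M}
    (h : ∀ X, α X x = 0) : D α x = 0 := by
  obtain ⟨e, δ, φ, hφ, hX, -⟩ := exists_smul_eq_sum_smul (E := E) x
  have hα : φ • α = ∑ i, α (e i) • δ i := by
    ext1 X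
    rw [LinearMap.smul_apply, ← map_smul, hX, map_sum, LinearMap.sum_apply]
    exact Finset.sum_congr rfl fun i _ => by
      rw [map_smul, LinearMap.smul_apply, smul_eq_mul, smul_eq_mul, mul_comm]
  calc D α x = D (φ • α) x := by
        rw [map_smul]
        change _ = φ x * D α x
        rw [hφ, one_mul]
    _ = ∑ i, α (e i) x * D (δ i) x := by
        simp only [hα, map_sum, map_smul, sum_function_apply]
        rfl
    _ = 0 := Finset.sum_eq_zero fun i _ => by rw [h, zero_mul]

lemma linearMap_apply_congr_of_oneForm [T2Space M]
    (D : OneForm E M →ₗ[SmoothFunction E M] SmoothFunction E M) {α γ : OneForm E M} {x : M}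
    (h : ∀ X, α X x = γ X x) : D α x = D γ x := by
  have h₁ : D (α - γ) x = 0 := linearMap_apply_eq_zero_of_oneForm D fun X => sub_eq_zero.2 (h X)
  rw [map_sub] at h₁
  exact sub_eq_zero.1 h₁

lemma exists_lieDerivFunction_apply_eq [T2Space M] (x : M)
    (ℓ : TangentSpace 𝓘(ℝ, E) x →ₗ[ℝ] ℝ) :
    ∃ f : SmoothFunction E M, ∀ X, lieDerivFunction X f x = ℓ (X x) := by
  obtain ⟨b⟩ : Nonempty (SmoothBumpFunction 𝓘(ℝ, E) x) := inferInstance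
  let ℓ' : E →L[ℝ] ℝ := LinearMap.toContinuousLinearMap (E := E) ℓ
  let g : M → ℝ := fun y => ℓ' (extChartAt 𝓘(ℝ, E) x y)
  refine ⟨⟨fun y => b y • g y, b.contMDiff_smul (ℓ'.contMDiff.comp_contMDiffOn
    contMDiffOn_extChartAt)⟩, fun X => ?_⟩
  have hg : (fun y => b y • g y) =ᶠ[nhds x] ℓ' ∘ extChartAt 𝓘(ℝ, E) x := by
    filter_upwards [b.eventuallyEq_one] with y hy
    simp only [hy, Pi.one_apply, one_smul, g, Function.comp_apply]
  change mfderiv 𝓘(ℝ, E) 𝓘(ℝ, ℝ) (fun y => b y • g y) x (X x) = ℓ (X x)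
  rw [hg.mfderiv_eq, mfderiv_comp x ℓ'.mdifferentiableAt
    (mdifferentiableAt_extChartAt (mem_chart_source E x)), mfderiv_extChartAt_self, ℓ'.mfderiv_eq]
  rfl

lemma exists_differentialFunction_apply_eq [T2Space M] (α : OneForm E M) (x : M) :
    ∃ f : SmoothFunction E M, ∀ X, α X x = differentialFunction f X x := by
  choose ext hext using exists_vectorField_apply (E := E) (M := M) x
  let ℓ : TangentSpace 𝓘(ℝ, E) x →ₗ[ℝ] ℝ :=
    { toFun := fun u => α (ext u) x
      map_add' := fun u v => by
        have h : (ext u + ext v) x = u + v := congrArg₂ (· + ·) (hext u) (hext v)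
        rw [oneForm_apply_congr α ((hext _).trans h.symm), map_add]
        rfl
      map_smul' := fun c u => by
        have h : (algebraMap ℝ (SmoothFunction E M) c • ext u) x = c • u :=
          congrArg (c • ·) (hext u)
        rw [oneForm_apply_congr α ((hext _).trans h.symm), map_smul]
        rfl }
  obtain ⟨f, hf⟩ := exists_lieDerivFunction_apply_eq x ℓ
  exact ⟨f, fun X => (oneForm_apply_congr α (hext _).symm).trans (hf X).symm⟩

lemma vectorField_apply_eq_zero [T2Space M] {X : SmoothVectorField E M} {x : M}
    (h : ∀ f, lieDerivFunction X f x = 0) : X x = 0 := by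
  have : FiniteDimensional ℝ (TangentSpace 𝓘(ℝ, E) x) := inferInstanceAs (FiniteDimensional ℝ E)
  refine (Module.forall_dual_apply_eq_zero_iff ℝ (X x)).1 fun ℓ => ?_
  obtain ⟨f, hf⟩ := exists_lieDerivFunction_apply_eq x ℓ
  exact (hf X).symm.trans (h f)

lemma vectorField_eq_of_lieDerivFunction [T2Space M] {X Y : SmoothVectorField E M}
    (h : ∀ f, lieDerivFunction X f = lieDerivFunction Y f) : X = Y := by
  rw [← sub_eq_zero]
  ext x
  refine vectorField_apply_eq_zero fun f => ?_
  rw [← differentialFunction_apply, map_sub, differentialFunction_apply, differentialFunction_apply,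
    h, sub_self]
  rfl

lemma vectorField_eq_of_oneForm [T2Space M] {X Y : SmoothVectorField E M}
    (h : ∀ α : OneForm E M, α X = α Y) : X = Y :=
  vectorField_eq_of_lieDerivFunction fun f => h (differentialFunction f)

end SmoothSections

namespace AnchoredBracket
variable {A L L' : Type*} [CommRing A] [Algebra ℝ A] [AddCommGroup L] [Module A L]
  [AddCommGroup L'] [Module A L']

/-- The failure of an anchor-preserving linear map to preserve the brackets. It is linear over the
functions because both brackets satisfy the same Leibniz rule. -/
def defect (B : AnchoredBracket A L) (B' : AnchoredBracket A L') (e : L →ₗ[A] L')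
    (ha : ∀ a, B'.anchor (e a) = B.anchor a) (a : L) : L →ₗ[A] L' where
  toFun b := e (B.bracket a b) - B'.bracket (e a) (e b)
  map_add' b c := by
    rw [B.bracket_add, map_add, map_add, B'.bracket_add]
    abel
  map_smul' f b := by
    rw [B.bracket_smul, map_add, map_smul, map_smul, map_smul, B'.bracket_smul, ha,
      RingHom.id_apply, smul_sub]
    abel

lemma defect_skew {B : AnchoredBracket A L} {B' : AnchoredBracket A L'} {e : L →ₗ[A] L'}
    (ha : ∀ a, B'.anchor (e a) = B.anchor a) (a b : L) :
    B.defect B' e ha a b = -B.defect B' e ha b a := by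
  change e (B.bracket a b) - B'.bracket (e a) (e b) = -(e (B.bracket b a) - B'.bracket (e b) (e a))
  rw [B.bracket_skew, B'.bracket_skew, map_neg, neg_sub_neg, neg_sub]

end AnchoredBracket

section Commutator
variable {E : Type*} [NormedAddCommGroup E] [NormedSpace ℝ E] [FiniteDimensional ℝ E]
  {M : Type*} [TopologicalSpace M] [ChartedSpace E M] [IsManifold 𝓘(ℝ, E) ∞ M]

lemma lieBracket_lieBracket (X Y Z : SmoothVectorField E M) :
    lieBracket X (lieBracket Y Z) =
      lieBracket (lieBracket X Y) Z + lieBracket Y (lieBracket X Z) := by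
  have hsmooth : (minSmoothness ℝ 2) ≤ ∞ := by
    rw [minSmoothness_of_isRCLikeNormedField]
    norm_cast
  have : IsManifold 𝓘(ℝ, E) (minSmoothness ℝ 3) M := by
    rw [minSmoothness_of_isRCLikeNormedField]
    exact IsManifold.of_le (n := ∞) (by norm_cast)
  have : CompleteSpace E := FiniteDimensional.complete ℝ E
  ext x
  exact congrFun (VectorField.leibniz_identity_mlieBracket (X.contMDiff.of_le hsmooth)
    (Y.contMDiff.of_le hsmooth) (Z.contMDiff.of_le hsmooth)) x

lemma lieBracket_smul (X : SmoothVectorField E M) (f : SmoothFunction E M)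
    (Y : SmoothVectorField E M) :
    lieBracket X (f • Y) = f • lieBracket X Y + lieDerivFunction X f • Y :=
  (tangentAlgebroid E M).bracket_smul X f Y

lemma lieBracket_add (X Y Z : SmoothVectorField E M) :
    lieBracket X (Y + Z) = lieBracket X Y + lieBracket X Z :=
  (tangentAlgebroid E M).bracket_add X Y Z

lemma lieDerivFunction_lieBracket (X Y : SmoothVectorField E M) (f : SmoothFunction E M) :
    lieDerivFunction (lieBracket X Y) f =
      lieDerivFunction X (lieDerivFunction Y f) - lieDerivFunction Y (lieDerivFunction X f) := by
  set c := lieDerivFunction (lieBracket X Y) f -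
    (lieDerivFunction X (lieDerivFunction Y f) - lieDerivFunction Y (lieDerivFunction X f)) with hc
  -- Compare the Jacobi identities for `W` and for `f • W`.
  have hsmul (W : SmoothVectorField E M) : c • W = 0 := by
    have h := lieBracket_lieBracket X Y (f • W)
    simp only [lieBracket_smul, lieBracket_add] at h
    rw [lieBracket_lieBracket X Y W] at h
    rw [hc]
    linear_combination (norm := module) -h
  have hmul (W : SmoothVectorField E M) (g : SmoothFunction E M) :
      c * lieDerivFunction W g = 0 := by
    have h : differentialFunction g (c • W) = 0 := by rw [hsmul, map_zero]
    rwa [map_smul] at h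
  have hcc : c * c = 0 := by
    conv_lhs => rw [hc, mul_sub, mul_sub, hmul, hmul, hmul, sub_zero, sub_zero]
  rw [← sub_eq_zero]
  ext x
  exact mul_self_eq_zero.1 (congrArg (fun g : SmoothFunction E M => g x) hcc)

end Commutator

namespace PoissonStructure
variable {E : Type*} [NormedAddCommGroup E] [NormedSpace ℝ E] [FiniteDimensional ℝ E]
  {M : Type*} [TopologicalSpace M] [ChartedSpace E M] [IsManifold 𝓘(ℝ, E) ∞ M]
  (P : PoissonStructure E M)

lemma functionBracket_skew (f g : SmoothFunction E M) :
    functionBracket P.sharp f g = -functionBracket P.sharp g f :=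
  P.bivector_skew _ _

lemma koszulBracket_differentialFunction (f g : SmoothFunction E M) :
    P.koszulBracket (differentialFunction f) (differentialFunction g) =
      differentialFunction (functionBracket P.sharp f g) := by
  have hskew : lieDerivFunction (P.sharp (differentialFunction g)) f =
      -lieDerivFunction (P.sharp (differentialFunction f)) g := P.functionBracket_skew g f
  have hneg (Y : SmoothVectorField E M) (h : SmoothFunction E M) :
      lieDerivFunction Y (-h) = -lieDerivFunction Y h := map_neg (toDerivation Y) h
  ext1 Y
  simp only [koszulBracket, bivector, functionBracket, LinearMap.sub_apply, lieDerivOneForm_apply,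
    differentialFunction_apply, lieDerivFunction_lieBracket, hskew, hneg]
  abel

lemma sharp_differentialFunction_functionBracket [T2Space M] (f g : SmoothFunction E M) :
    P.sharp (differentialFunction (functionBracket P.sharp f g)) =
      lieBracket (P.sharp (differentialFunction f)) (P.sharp (differentialFunction g)) := by
  refine vectorField_eq_of_lieDerivFunction fun h => ?_
  have hneg (Y : SmoothVectorField E M) (h : SmoothFunction E M) :
      lieDerivFunction Y (-h) = -lieDerivFunction Y h := map_neg (toDerivation Y) h
  have hJ := P.jacobi f g h
  rw [P.functionBracket_skew (functionBracket P.sharp g h) f,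
    P.functionBracket_skew (functionBracket P.sharp h f) g, P.functionBracket_skew h f] at hJ
  simp only [functionBracket, differentialFunction_apply, hneg] at hJ
  simp only [functionBracket, differentialFunction_apply, lieDerivFunction_lieBracket]
  linear_combination hJ

lemma sharp_koszulBracket [T2Space M] (α γ : OneForm E M) :
    P.sharp (P.koszulBracket α γ) = lieBracket (P.sharp α) (P.sharp γ) := by
  let D := P.cotangentAlgebroid.defect (tangentAlgebroid E M) P.sharp fun _ => rfl
  have hexact (f g : SmoothFunction E M) :
      D (differentialFunction f) (differentialFunction g) = 0 := by
    refine sub_eq_zero.2 ?_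
    change P.sharp (P.koszulBracket _ _) = _
    rw [P.koszulBracket_differentialFunction]
    exact P.sharp_differentialFunction_functionBracket f g
  have hskew : ∀ a b, D a b = -D b a := AnchoredBracket.defect_skew _
  suffices h : D α γ = 0 from sub_eq_zero.1 h
  ext x
  refine vectorField_apply_eq_zero fun h => ?_
  -- `D` is tensorial, so at `x` both arguments may be replaced by differentials of functions.
  obtain ⟨f, hf⟩ := exists_differentialFunction_apply_eq α x
  obtain ⟨g, hg⟩ := exists_differentialFunction_apply_eq γ x
  calc differentialFunction h (D α γ) x
      = differentialFunction h (D α (differentialFunction g)) x :=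
        linearMap_apply_congr_of_oneForm (differentialFunction h ∘ₗ D α) hg
    _ = -differentialFunction h (D (differentialFunction g) α) x := by
        rw [hskew, map_neg]
        rfl
    _ = -differentialFunction h (D (differentialFunction g) (differentialFunction f)) x :=
        congrArg Neg.neg (linearMap_apply_congr_of_oneForm
          (differentialFunction h ∘ₗ D (differentialFunction g)) hf)
    _ = 0 := by
        rw [hexact, map_zero]
        exact neg_zero

end PoissonStructure

section Distributions
variable {E : Type*} [NormedAddCommGroup E] [NormedSpace ℝ E]
  {M : Type*} [TopologicalSpace M] [ChartedSpace E M]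

lemma contMDiff_of_mul_eq {h : M → ℝ}
    (H : ∀ x, ∃ l g : SmoothFunction E M, l x ≠ 0 ∧ ∀ y, l y * h y = g y) :
    ContMDiff 𝓘(ℝ, E) 𝓘(ℝ, ℝ) ∞ h := by
  intro x
  obtain ⟨l, g, hl, hg⟩ := H x
  refine (g.contMDiff.contMDiffAt.div₀ l.contMDiff.contMDiffAt hl).congr_of_eventuallyEq ?_
  filter_upwards [l.contMDiff.continuous.continuousAt.eventually_ne hl] with y hy
  change h y = g y / l y
  rw [eq_div_iff hy, mul_comm, hg]

variable [IsManifold 𝓘(ℝ, E) ∞ M]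

lemma contMDiff_of_smul_eq {X : ∀ x : M, TangentSpace 𝓘(ℝ, E) x}
    (H : ∀ x, ∃ (l : SmoothFunction E M) (Y : SmoothVectorField E M),
      l x ≠ 0 ∧ ∀ y, l y • X y = Y y) :
    ContMDiff 𝓘(ℝ, E) (𝓘(ℝ, E).prod 𝓘(ℝ, E)) ∞
      fun x => (Bundle.TotalSpace.mk' E x (X x) : TangentBundle 𝓘(ℝ, E) M) := by
  have := contMDiffVectorBundle_tangent (E := E) (M := M)
  intro x
  obtain ⟨l, Y, hl, hY⟩ := H x
  refine ((l.contMDiff.contMDiffAt.inv₀ hl).smul_section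
    Y.contMDiff.contMDiffAt).congr_of_eventuallyEq ?_
  filter_upwards [l.contMDiff.continuous.continuousAt.eventually_ne hl] with y hy
  change Bundle.TotalSpace.mk' E y _ = Bundle.TotalSpace.mk' E y ((l y)⁻¹ • Y y)
  rw [← hY, inv_smul_smul₀ hy]

variable [FiniteDimensional ℝ E] [T2Space M] {r : ℕ}
  {e : Fin r → SmoothVectorField E M}

lemma oneForm_apply_eq_sum (α : OneForm E M) {X : SmoothVectorField E M} {x : M} {c : Fin r → ℝ}
    (h : X x = ∑ i, c i • e i x) : α X x = ∑ i, c i * α (e i) x := by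
  let Y : SmoothVectorField E M := ∑ i, algebraMap ℝ (SmoothFunction E M) (c i) • e i
  have hY : X x = Y x := by
    rw [h, sum_vectorField_apply]
    rfl
  rw [oneForm_apply_congr α hY, map_sum, sum_function_apply]
  simp only [map_smul]
  rfl

lemma exists_dual_oneForms {x : M} (he : LinearIndependent ℝ fun i => e i x) :
    ∃ (γ : Fin r → OneForm E M) (l : SmoothFunction E M), l x ≠ 0 ∧
      ∀ i j, γ i (e j) = if i = j then l else 0 := by
  obtain ⟨g, hg⟩ := (Fintype.linearCombination ℝ fun i => e i x).exists_leftInverse_of_injective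
    (LinearMap.ker_eq_bot.2 (linearIndependent_iff_injective_fintypeLinearCombination.1 he))
  have hge (j) : g (e j x) = Pi.single j 1 := by
    simpa [Fintype.linearCombination_apply_single] using DFunLike.congr_fun hg (Pi.single j 1)
  choose f hf using fun i => exists_lieDerivFunction_apply_eq x (LinearMap.proj i ∘ₗ g)
  let D : Matrix (Fin r) (Fin r) (SmoothFunction E M) :=
    Matrix.of fun i j => differentialFunction (f i) (e j)
  let evx : SmoothFunction E M →+* ℝ := ContMDiffMap.evalRingHom x
  have hD : evx.mapMatrix D = 1 := by
    ext i j
    refine (hf i (e j)).trans ?_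
    rw [LinearMap.comp_apply, hge, LinearMap.proj_apply, Matrix.one_apply, Pi.single_apply]
  refine ⟨fun i => ∑ k, D.adjugate i k • differentialFunction (f k), D.det, ?_, fun i j => ?_⟩
  · have hdet : evx D.det = 1 := by rw [RingHom.map_det, hD, Matrix.det_one]
    exact hdet.trans_ne one_ne_zero
  · have h := congrFun₂ (Matrix.adjugate_mul D) i j
    rw [Matrix.smul_apply, Matrix.one_apply, smul_ite, smul_zero, smul_eq_mul, mul_one] at h
    rw [LinearMap.sum_apply, ← h]
    rfl

lemma dual_oneForm_apply {γ : Fin r → OneForm E M} {l : SmoothFunction E M}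
    (hγ : ∀ i j, γ i (e j) = if i = j then l else 0) {X : SmoothVectorField E M} {x : M}
    {c : Fin r → ℝ} (hX : X x = ∑ i, c i • e i x) (j : Fin r) : γ j X x = c j * l x := by
  rw [oneForm_apply_eq_sum (γ j) hX, Finset.sum_eq_single j (fun i _ hij => ?_)
    (fun h => absurd (Finset.mem_univ j) h), hγ, if_pos rfl]
  rw [hγ, if_neg hij.symm]
  exact mul_zero _

lemma linearIndependent_of_dual_oneForms {γ : Fin r → OneForm E M} {l : SmoothFunction E M}
    (hγ : ∀ i j, γ i (e j) = if i = j then l else 0) {x : M} (hl : l x ≠ 0) :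
    LinearIndependent ℝ fun i => e i x := by
  rw [Fintype.linearIndependent_iff]
  intro c hc j
  have h := dual_oneForm_apply hγ (X := 0) hc.symm j
  rw [map_zero] at h
  exact (mul_eq_zero.1 h.symm).resolve_right hl

lemma exists_smul_eq_sum_smul_of_mem {F : ∀ x : M, Submodule ℝ (TangentSpace 𝓘(ℝ, E) x)}
    (hF : ∀ x, Module.finrank ℝ (F x) = r) (heF : ∀ i x, e i x ∈ F x) {x : M}
    (he : LinearIndependent ℝ fun i => e i x) :
    ∃ (δ : Fin r → OneForm E M) (l : SmoothFunction E M), l x ≠ 0 ∧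
      ∀ X : SmoothVectorField E M, (∀ y, X y ∈ F y) → l • X = ∑ i, δ i X • e i := by
  obtain ⟨γ, l, hl, hγ⟩ := exists_dual_oneForms he
  refine ⟨fun i => l • γ i, l * l, mul_ne_zero hl hl, fun X hX => ?_⟩
  ext y
  rw [sum_vectorField_apply]
  change (l y * l y) • X y = ∑ i, (l y * γ i X y) • e i y
  by_cases hy : l y = 0
  · simp only [hy, zero_mul, zero_smul, Finset.sum_const_zero]
  have : FiniteDimensional ℝ (TangentSpace 𝓘(ℝ, E) y) :=
    inferInstanceAs (FiniteDimensional ℝ E)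
  have hli : LinearIndependent ℝ fun i => (⟨e i y, heF i y⟩ : F y) :=
    LinearIndependent.of_comp (F y).subtype (linearIndependent_of_dual_oneForms hγ hy)
  have hspan := hli.span_eq_top_of_card_eq_finrank' (by rw [hF y, Fintype.card_fin])
  obtain ⟨c, hc⟩ := (Submodule.mem_span_range_iff_exists_fun ℝ).1
    (hspan.symm ▸ Submodule.mem_top : (⟨X y, hX y⟩ : F y) ∈ _)
  have hXc : X y = ∑ i, c i • e i y := by simpa using (congrArg (F y).subtype hc).symm
  simp only [dual_oneForm_apply hγ hXc, hXc, Finset.smul_sum, smul_smul]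
  exact Finset.sum_congr rfl fun i _ => by rw [mul_right_comm, mul_assoc]

end Distributions

namespace PoissonStructure
variable {E : Type*} [NormedAddCommGroup E] [NormedSpace ℝ E]
  {M : Type*} [TopologicalSpace M] [ChartedSpace E M] [IsManifold 𝓘(ℝ, E) ∞ M]
  [FiniteDimensional ℝ E] (P : PoissonStructure E M) {r : ℕ}

lemma sharp_mem_tangentialFields (α : OneForm E M) : P.sharp α ∈ P.tangentialFields :=
  fun _ => ⟨α, rfl⟩

lemma oneForm_sharp (α γ : OneForm E M) : α (P.sharp γ) = -γ (P.sharp α) :=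
  P.bivector_skew γ α

variable [T2Space M]

lemma sharp_eq_zero_of_mem_dualAnnihilator {α : OneForm E M}
    (hα : α ∈ P.tangentialFields.dualAnnihilator) : P.sharp α = 0 :=
  vectorField_eq_of_oneForm fun γ => by
    rw [P.oneForm_sharp, (Submodule.mem_dualAnnihilator α).1 hα _ (P.sharp_mem_tangentialFields γ),
      neg_zero, map_zero]

lemma oneForm_apply_congr_of_sharp {γ δ : OneForm E M} {Z : SmoothVectorField E M} {x : M}
    (h : P.sharp γ x = P.sharp δ x) (hZ : Z x ∈ P.leafTangent x) : γ Z x = δ Z x := by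
  obtain ⟨η, hη⟩ := hZ
  rw [← oneForm_apply_congr γ hη, ← oneForm_apply_congr δ hη, P.oneForm_sharp, P.oneForm_sharp δ]
  exact congrArg Neg.neg (oneForm_apply_congr η h)

lemma IsRegularOfRank.exists_smul_eq_sum_smul_sharp {P : PoissonStructure E M}
    (hP : P.IsRegularOfRank r) (x : M) :
    ∃ (α δ : Fin r → OneForm E M) (l : SmoothFunction E M), l x ≠ 0 ∧
      ∀ X ∈ P.tangentialFields, l • X = ∑ i, δ i X • P.sharp (α i) := by
  have : FiniteDimensional ℝ (TangentSpace 𝓘(ℝ, E) x) := inferInstanceAs (FiniteDimensional ℝ E)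
  let b := Module.finBasisOfFinrankEq ℝ (P.leafTangent x) (hP x)
  choose α hα using fun i => (b i).2
  have hli : LinearIndependent ℝ fun i => P.sharp (α i) x := by
    simp only [hα]
    exact b.linearIndependent.map' (P.leafTangent x).subtype (Submodule.ker_subtype _)
  obtain ⟨δ, l, hl, h⟩ := exists_smul_eq_sum_smul_of_mem (F := P.leafTangent) hP
    (fun i => P.sharp_mem_tangentialFields (α i)) hli
  exact ⟨α, δ, l, hl, h⟩

namespace TransversalDistribution
variable {P} (ν : P.TransversalDistribution)

lemma sharp_projection (α : OneForm E M) :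
    P.sharp (ν.fields.dualAnnihilator.projection _ ν.isCompl_annihilators α) = P.sharp α := by
  rw [← sub_eq_zero, ← map_sub]
  refine P.sharp_eq_zero_of_mem_dualAnnihilator ?_
  rw [← neg_mem_iff, neg_sub]
  exact Submodule.sub_projection_mem ν.isCompl_annihilators α

lemma exists_sharp_eq (hP : P.IsRegularOfRank r) {X : SmoothVectorField E M}
    (hX : X ∈ P.tangentialFields) : ∃ γ ∈ ν.fields.dualAnnihilator, P.sharp γ = X := by
  let π := P.tangentialFields.projection ν.fields ν.isCompl_fields
  choose η hη using hX
  have smooth (Z) : ContMDiff 𝓘(ℝ, E) 𝓘(ℝ, ℝ) ∞ fun x => η x (π Z) x := by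
    refine contMDiff_of_mul_eq fun x => ?_
    obtain ⟨α, δ, l, hl, h⟩ := hP.exists_smul_eq_sum_smul_sharp x
    refine ⟨l, (∑ i, δ i X • α i) (π Z), hl, fun y => ?_⟩
    refine P.oneForm_apply_congr_of_sharp (γ := algebraMap ℝ (SmoothFunction E M) (l y) • η y) ?_
      (Submodule.projection_apply_mem ν.isCompl_fields Z y)
    simp only [map_smul, map_sum, ← h X fun z => ⟨η z, hη z⟩]
    exact congrArg (l y • ·) (hη y)
  let γ : OneForm E M :=
    { toFun := fun Z => ⟨_, smooth Z⟩
      map_add' := fun Y Z => by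
        ext x
        change η x (π (Y + Z)) x = (η x (π Y) + η x (π Z)) x
        rw [map_add, map_add]
      map_smul' := fun f Z => by
        ext x
        change η x (π (f • Z)) x = (f • η x (π Z)) x
        rw [map_smul, map_smul] }
  have hγ (Z x) : γ Z x = η x (π Z) x := rfl
  refine ⟨γ, (Submodule.mem_dualAnnihilator _).2 fun Z hZ => ?_,
    vectorField_eq_of_oneForm fun δ => ?_⟩
  · ext x
    rw [hγ, (Submodule.projection_apply_eq_zero_iff ν.isCompl_fields).2 hZ, map_zero]
  · ext x
    rw [P.oneForm_sharp]
    change -γ (P.sharp δ) x = _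
    rw [hγ, Submodule.projection_apply_of_mem_left ν.isCompl_fields
      (P.sharp_mem_tangentialFields δ), P.oneForm_sharp, ← oneForm_apply_congr δ (hη x)]
    exact neg_neg _

lemma lieBracket_mem (ν : P.TransversalDistribution) (hP : P.IsRegularOfRank r)
    {X Y : SmoothVectorField E M} (hX : X ∈ P.tangentialFields) (hY : Y ∈ P.tangentialFields) :
    lieBracket X Y ∈ P.tangentialFields := by
  obtain ⟨α, -, rfl⟩ := ν.exists_sharp_eq hP hX
  obtain ⟨γ, -, rfl⟩ := ν.exists_sharp_eq hP hY
  rw [← P.sharp_koszulBracket]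
  exact P.sharp_mem_tangentialFields _

/-- The symplectic form of the leaves identifies tangential 1-forms with tangential vector
fields. -/
def sharpEquiv (hP : P.IsRegularOfRank r) :
    ν.fields.dualAnnihilator ≃ₗ[SmoothFunction E M] P.tangentialFields :=
  LinearEquiv.ofBijective ((P.sharp ∘ₗ ν.fields.dualAnnihilator.subtype).codRestrict
    P.tangentialFields fun α => P.sharp_mem_tangentialFields α) <| by
  constructor
  · rw [injective_iff_map_eq_zero]
    rintro ⟨α, hα⟩ h
    have h₀ : P.sharp α = 0 := congrArg Subtype.val h
    refine Subtype.ext (Submodule.disjoint_def.1 ν.isCompl_annihilators.disjoint α hα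
      ((Submodule.mem_dualAnnihilator α).2 fun X hX => ?_))
    obtain ⟨γ, -, rfl⟩ := ν.exists_sharp_eq hP hX
    rw [P.oneForm_sharp, h₀, map_zero, neg_zero]
  · rintro ⟨X, hX⟩
    obtain ⟨γ, hγ, rfl⟩ := ν.exists_sharp_eq hP hX
    exact ⟨⟨γ, hγ⟩, rfl⟩

lemma sharpEquiv_bracket (hP : P.IsRegularOfRank r) (α γ : ν.fields.dualAnnihilator) :
    ν.sharpEquiv hP ((P.cotangentAlgebroid.restrict ν.isCompl_annihilators).bracket α γ) =
      ((tangentAlgebroid E M).restrict ν.isCompl_fields).bracket (ν.sharpEquiv hP α)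
        (ν.sharpEquiv hP γ) :=
  Subtype.ext <| calc
    P.sharp (ν.fields.dualAnnihilator.projection _ ν.isCompl_annihilators (P.koszulBracket α γ))
      = lieBracket (P.sharp α) (P.sharp γ) := by rw [ν.sharp_projection, P.sharp_koszulBracket]
    _ = P.tangentialFields.projection ν.fields ν.isCompl_fields
          (lieBracket (P.sharp α) (P.sharp γ)) :=
      (Submodule.projection_apply_of_mem_left ν.isCompl_fields (ν.lieBracket_mem hP
        (P.sharp_mem_tangentialFields α) (P.sharp_mem_tangentialFields γ))).symm

lemma alternatingMap_eq_zero (hP : P.IsRegularOfRank r)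
    (q : ν.fields.dualAnnihilator [⋀^Fin (r + 1)]→ₗ[SmoothFunction E M] SmoothFunction E M) :
    q = 0 := by
  ext v x
  obtain ⟨α, δ, l, hl, h⟩ := hP.exists_smul_eq_sum_smul_sharp x
  let e (i : Fin r) := (ν.sharpEquiv hP).symm ⟨P.sharp (α i), P.sharp_mem_tangentialFields (α i)⟩
  have he (a : ν.fields.dualAnnihilator) : ∃ t : Fin r → SmoothFunction E M,
      l • a = ∑ i, t i • e i := by
    refine ⟨fun i => δ i (P.sharp a), (ν.sharpEquiv hP).injective (Subtype.ext ?_)⟩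
    simp only [map_smul, map_sum, e, LinearEquiv.apply_symm_apply, Submodule.coe_smul,
      Submodule.coe_sum]
    exact h _ (P.sharp_mem_tangentialFields a)
  have hx := congrArg (fun g : SmoothFunction E M => g x)
    (pow_mul_alternatingMap_eq_zero he (by simp) q v)
  change l x ^ (r + 1) * q v x = 0 at hx
  exact (mul_eq_zero.1 hx).resolve_left (pow_ne_zero _ hl)

end TransversalDistribution
end PoissonStructure

lemma AnchoredBracket.differentialFun_one {A L : Type*} [CommRing A] [Algebra ℝ A]
    [AddCommGroup L] [Module A L] (B : AnchoredBracket A L) (Q : L [⋀^Fin 1]→ₗ[A] A) (x y : L) :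
    B.differentialFun Q ![x, y] =
      B.anchor x (Q fun _ => y) - B.anchor y (Q fun _ => x) - Q fun _ => B.bracket x y := by
  have hIio₀ : Finset.Iio (0 : Fin 2) = ∅ := rfl
  have hIio₁ : Finset.Iio (1 : Fin 2) = {0} := rfl
  have hremove₀ (v : Fin 2 → L) : Fin.removeNth (0 : Fin 2) v = fun _ => v 1 := by
    funext i
    fin_cases i
    rfl
  have hremove₁ (v : Fin 2 → L) : Fin.removeNth (1 : Fin 2) v = fun _ => v 0 := by
    funext i
    fin_cases i
    rfl
  rw [differentialFun, Fin.sum_univ_two, Fin.sum_univ_two, hIio₀, hIio₁, Finset.sum_empty,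
    Finset.sum_singleton, hremove₀, hremove₁, hremove₁, Function.update_self]
  simp
  ring

namespace PoissonStructure
variable {E : Type*} [NormedAddCommGroup E] [NormedSpace ℝ E]
  {M : Type*} [TopologicalSpace M] [ChartedSpace E M] [IsManifold 𝓘(ℝ, E) ∞ M]
  [FiniteDimensional ℝ E]

namespace TransversalDistribution
variable {P : PoissonStructure E M} (ν : P.TransversalDistribution)

lemma oneForm_smul_comm {β : OneForm E M}
    (hβ : ∀ (X : SmoothVectorField E M) (x : M), β X x = 0 ↔ X x ∈ P.leafTangent x)
    {V W : SmoothVectorField E M} (hV : V ∈ ν.fields) (hW : W ∈ ν.fields) :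
    β V • W = β W • V := by
  rw [← sub_eq_zero]
  refine (Submodule.disjoint_def.1 ν.isCompl_fields.disjoint) _ (fun x => (hβ _ x).1 ?_)
    (sub_mem (Submodule.smul_mem _ _ hW) (Submodule.smul_mem _ _ hV))
  rw [map_sub, map_smul, map_smul, smul_eq_mul, smul_eq_mul, mul_comm, sub_self]
  rfl

lemma exists_oneForm_apply_eq_one [T2Space M] {β : OneForm E M}
    (hβ : ∀ (X : SmoothVectorField E M) (x : M), β X x = 0 ↔ X x ∈ P.leafTangent x)
    (hP : ∀ x : M, P.leafTangent x ≠ ⊤) : ∃ Y ∈ ν.fields, β Y = 1 := by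
  have hW (x : M) : ∃ W ∈ ν.fields, β W x ≠ 0 := by
    obtain ⟨u, hu⟩ := SetLike.exists_not_mem_of_ne_top _ (hP x)
    obtain ⟨X, rfl⟩ := exists_vectorField_apply x u
    obtain ⟨W, hW⟩ := ν.smooth X
    refine ⟨W, fun y => (hW y).1, fun h => hu ?_⟩
    have := add_mem (hW x).2 ((hβ W x).1 h)
    rwa [sub_add_cancel] at this
  choose W hWν hW₀ using hW
  have hWx (x y : M) : β (W x) y • ((β (W y) y)⁻¹ • W y y) = W x y := by
    have h : β (W x) y • W y y = β (W y) y • W x y :=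
      congrArg (fun Z : SmoothVectorField E M => Z y) (ν.oneForm_smul_comm hβ (hWν x) (hWν y))
    rw [smul_comm, h, inv_smul_smul₀ (hW₀ y)]
  let Y : SmoothVectorField E M :=
    ⟨fun y => (β (W y) y)⁻¹ • W y y,
      contMDiff_of_smul_eq fun x => ⟨β (W x), W x, hW₀ x, hWx x⟩⟩
  refine ⟨Y, fun x => (ν.fiber x).smul_mem _ (hWν x x), ?_⟩
  ext x
  have hY : β (W x) • Y = W x := by
    ext y
    exact hWx x y
  have h : β (W x) x * β Y x = β (W x) x := by
    conv_rhs => rw [← hY, map_smul]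
    rfl
  exact mul_left_cancel₀ (hW₀ x) (h.trans (mul_one _).symm)

/-- A closed 1-form with the tangent spaces of the leaves as its kernels, together with the vector
field in the transversal distribution on which it is `1`. -/
structure ClosedCoorientation where
  form : OneForm E M
  form_apply_eq_zero : ∀ (X : SmoothVectorField E M) (x : M), form X x = 0 ↔ X x ∈ P.leafTangent x
  closed : ∀ X Y, lieDerivFunction X (form Y) - lieDerivFunction Y (form X) -
    form (lieBracket X Y) = 0
  field : SmoothVectorField E M
  field_mem : field ∈ ν.fields
  form_field : form field = 1

namespace ClosedCoorientation
variable {ν} (u : ν.ClosedCoorientation)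

lemma mem_tangentialFields {X : SmoothVectorField E M} :
    X ∈ P.tangentialFields ↔ u.form X = 0 := by
  constructor
  · intro h
    ext x
    exact (u.form_apply_eq_zero X x).2 (h x)
  · intro h x
    rw [← u.form_apply_eq_zero, h]
    rfl

/-- The decomposition of the vector fields into tangential and transversal ones. -/
def fieldComplement : LineComplement P.tangentialFields ν.fields where
  isCompl := ν.isCompl_fields
  gen := u.field
  gen_mem := u.field_mem
  coord := u.form
  coord_of_mem _ h := u.mem_tangentialFields.1 h
  coord_gen := u.form_field
  coord_smul_gen v hv := by
    rw [ν.oneForm_smul_comm u.form_apply_eq_zero hv u.field_mem, u.form_field, one_smul]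

lemma lieBracket_field_mem {X : SmoothVectorField E M} (hX : X ∈ P.tangentialFields) :
    lieBracket u.field X ∈ P.tangentialFields := by
  have h := u.closed u.field X
  rw [u.mem_tangentialFields.1 hX, u.form_field, ← anchor_apply, ← anchor_apply, map_zero,
    Derivation.map_one_eq_zero, sub_zero, zero_sub, neg_eq_zero] at h
  exact u.mem_tangentialFields.2 h

/-- The decomposition of the 1-forms into tangential and transversal ones. -/
def formComplement :
    LineComplement ν.fields.dualAnnihilator P.tangentialFields.dualAnnihilator where
  isCompl := ν.isCompl_annihilators
  gen := u.form
  gen_mem := (Submodule.mem_dualAnnihilator _).2 fun _ h => u.mem_tangentialFields.1 h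
  coord := LinearMap.applyₗ u.field
  coord_of_mem α hα := (Submodule.mem_dualAnnihilator α).1 hα _ u.field_mem
  coord_gen := u.form_field
  coord_smul_gen α hα := by
    ext1 X
    have hX : X - u.form X • u.field ∈ P.tangentialFields := by
      rw [u.mem_tangentialFields, map_sub, map_smul, u.form_field, smul_eq_mul, mul_one, sub_self]
    have h : α X = u.form X * α u.field := by
      rw [← sub_eq_zero, ← smul_eq_mul, ← map_smul, ← map_sub,
        (Submodule.mem_dualAnnihilator α).1 hα _ hX]
    rw [h]
    exact mul_comm _ _

variable [T2Space M]

lemma sharp_form : P.sharp u.form = 0 :=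
  P.sharp_eq_zero_of_mem_dualAnnihilator u.formComplement.gen_mem

lemma koszulBracket_form (α : OneForm E M) : P.koszulBracket u.form α = 0 := by
  ext1 W
  have hform : u.form (P.sharp α) = 0 :=
    u.mem_tangentialFields.1 (P.sharp_mem_tangentialFields α)
  have hclosed := u.closed (P.sharp α) W
  have hbracket : lieBracket (0 : SmoothVectorField E M) W = 0 := by
    have h : lieBracket _ W = _ := (tangentAlgebroid E M).smul_bracket 0 0 W
    rwa [zero_smul, zero_smul, smul_zero, sub_zero] at h
  rw [hform] at hclosed
  simp only [koszulBracket, bivector, LinearMap.sub_apply, lieDerivOneForm_apply,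
    differentialFunction_apply, u.sharp_form, hbracket, map_zero, ← anchor_apply,
    Derivation.zero_apply, LinearMap.zero_apply] at hclosed ⊢
  linear_combination -hclosed

lemma isCentral_formComplement : u.formComplement.IsCentral P.cotangentAlgebroid where
  anchor_gen := by
    change (tangentAlgebroid E M).anchor (P.sharp u.form) = 0
    rw [u.sharp_form, map_zero]
  bracket_gen α _ := u.koszulBracket_form α

/-- The cohomology with values in the projectable 1-forms is the cohomology of the tangential
1-forms with the projected bracket. -/
def projectableCohomologyEquiv {r : ℕ} (hP : P.IsRegularOfRank r) (q : ℕ) :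
    ν.ProjectableCohomology q 1 ≃ₗ[P.casimirs]
      RestrictedCohomology P.cotangentAlgebroid P.casimirs
        (fun _ hf α _ => P.anchor_casimir hf α) ν.isCompl_annihilators q :=
  (leafCohomologyOneEquiv (tangentAlgebroid E M) P.casimirs
    (fun _ hf _ hX => P.tangential_casimir hf hX) u.fieldComplement
    (fun _ h => u.lieBracket_field_mem h) q).trans
  (totalCohomologyEquiv _ _ P.casimirs _ _ (ν.sharpEquiv hP) (fun _ => rfl)
    (ν.sharpEquiv_bracket hP) q)

end ClosedCoorientation

lemma exists_closedCoorientation [T2Space M] {β : DifferentialForm E M 1}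
    (hβ : P.DefinesFoliation β) (hdβ : exteriorDerivative E M 1 β = 0)
    (hP : ∀ x : M, P.leafTangent x ≠ ⊤) : Nonempty ν.ClosedCoorientation := by
  let b : OneForm E M := (AlternatingMap.ofSubsingleton _ _ _ (0 : Fin 1)).symm β
  obtain ⟨Y, hY, hbY⟩ := ν.exists_oneForm_apply_eq_one (β := b) hβ hP
  refine ⟨⟨b, hβ, fun X Z => ?_, Y, hY, hbY⟩⟩
  rw [← anchor_apply, ← anchor_apply]
  exact ((tangentAlgebroid E M).differentialFun_one β X Z).symm.trans
    (congrArg (fun θ : DifferentialForm E M 2 => θ ![X, Z]) hdβ)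

end TransversalDistribution
end PoissonStructure

end PoissonGeom
end

theorem proposition6_general {E : Type*} [NormedAddCommGroup E] [NormedSpace ℝ E]
    [FiniteDimensional ℝ E] {m : ℕ} (hE : Module.finrank ℝ E = m + 2)
    {M : Type*} [TopologicalSpace M] [T2Space M] [ChartedSpace E M] [IsManifold 𝓘(ℝ, E) ∞ M]
    (P : PoissonStructure E M) (hP : P.IsRegularOfRank (m + 1))
    (β : DifferentialForm E M 1) (hβ : P.DefinesFoliation β)
    (hdβ : exteriorDerivative E M 1 β = 0) (ν : P.TransversalDistribution) :
    Nonempty (P.PCohomology (m + 1) ≃ₗ[ℝ]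
        (ν.TPCohomology (m + 1) ⧸ transverseClasses P.cotangentAlgebroid ν.isCompl_annihilators
          P.casimirs (fun _ hf α _ => P.anchor_casimir hf α)
          (fun _ hf α => P.anchor_casimir hf α) m) × ν.ProjectableCohomology m 1) ∧
      Nonempty (P.PCohomology (m + 2) ≃ₗ[P.casimirs] ν.ProjectableCohomology (m + 1) 1) ∧
      ∀ q : ℕ, Nonempty (ν.TPCohomology q ≃ₗ[P.casimirs] ν.ProjectableCohomology q 1) := by
  have leafTangent_ne_top (x : M) : P.leafTangent x ≠ ⊤ := fun h => by
    have hx := hP x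
    rw [h, finrank_top, show Module.finrank ℝ (TangentSpace 𝓘(ℝ, E) x) = m + 2 from hE] at hx
    omega
  obtain ⟨u⟩ := ν.exists_closedCoorientation hβ hdβ leafTangent_ne_top
  have hu := u.isCentral_formComplement
  have hv := ν.alternatingMap_eq_zero hP
  have hR : ∀ f ∈ P.casimirs, ∀ α, P.cotangentAlgebroid.anchor α f = 0 :=
    fun _ hf α => P.anchor_casimir hf α
  refine ⟨?_, ⟨?_⟩, fun q => ⟨?_⟩⟩
  · obtain ⟨e⟩ := exists_equiv_quotient_prod (hu.ker_leafToTotal P.casimirs hR hv)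
      (hu.range_leafToTotal P.casimirs hR hv) (hu.totalToRestricted_surjective P.casimirs hR hv)
    exact ⟨e.trans (LinearEquiv.prodCongr (LinearEquiv.refl ℝ _)
      ((u.projectableCohomologyEquiv hP m).symm.restrictScalars ℝ))⟩
  · exact (LinearEquiv.ofBijective _ (hu.totalToRestricted_bijective P.casimirs hR hv)).trans
      (u.projectableCohomologyEquiv hP (m + 1)).symm
  · exact (leafCohomologyZeroEquiv P.cotangentAlgebroid P.casimirs (fun f hf α _ => hR f hf α)
      ν.isCompl_annihilators q).trans (u.projectableCohomologyEquiv hP q).symm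

theorem proposition6 {M : Type*} [TopologicalSpace M] [T2Space M] [SecondCountableTopology M]
    [ChartedSpace (EuclideanSpace ℝ (Fin 3)) M] [IsManifold 𝓘(ℝ, EuclideanSpace ℝ (Fin 3)) ∞ M]
    (hM : IsOrientable (EuclideanSpace ℝ (Fin 3)) M)
    (P : PoissonStructure (EuclideanSpace ℝ (Fin 3)) M) (hP : P.IsRegularOfRank 2)
    (β : DifferentialForm (EuclideanSpace ℝ (Fin 3)) M 1) (hβ : P.DefinesFoliation β)
    (hdβ : exteriorDerivative (EuclideanSpace ℝ (Fin 3)) M 1 β = 0)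
    (ν : P.TransversalDistribution) :
    Nonempty (P.PCohomology 2 ≃ₗ[ℝ]
        (ν.TPCohomology 2 ⧸ ν.sigmaTransversal) × ν.ProjectableCohomology 1 1) ∧
      Nonempty (P.PCohomology 3 ≃ₗ[P.casimirs] ν.ProjectableCohomology 2 1) ∧
      ∀ q : ℕ, Nonempty (ν.TPCohomology q ≃ₗ[P.casimirs] ν.ProjectableCohomology q 1) :=
  proposition6_general finrank_euclideanSpace_fin P hP β hβ hdβ ν
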